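/- Let $k$ be a field and let $A$ be a finite dimensional Frobenius $k$-algebra, i.e. $A$ carries a non-degenerate bilinear form with $\langle ab,c\rangle=\langle a,bc\rangle$. Put $A^{e}=A\otimes_k A^{\circ}$; $A$-bimodules (with $k$ acting centrally) are regarded as left $A^{e}$-modules via $(a\otimes b^{\circ})m=amb$ and as right $A^{e}$-modules via $m(a\otimes b^{\circ})=bma$. Let $T\xrightarrow{\varepsilon}A$ be a complete resolution of $A$ over $A^{e}$: an acyclic complex $T=(T_i,d_i)_{i\in\mathbb Z}$ of finitely generated projective $A$-bimodules such that $\operatorname{Hom}_{A^{e}}(T,A^{e})$ is acyclic, together with an augmentation $\varepsilon:T_0\to A$ such that $T_1\xrightarrow{d_1}T_0\xrightarrow{\varepsilon}A\to0$ is exact. For an $A$-bimodule $M$ and $n\in\mathbb Z$ let $$\widehat H^{n}(A,M)=H^{n}(\operatorname{Hom}_{A^{e}}(T,M)),\qquad \widehat H_{n}(A,M)=H_{n}(T\otimes_{A^{e}}M).$$ Let $T\widehat\otimes_A T$ be the complete tensor product, with components $(T\widehat\otimes_A T)_n=\prod_{i+j=n}T_i\otimes_A T_j$ and differential $d\,\widehat\otimes\,\mathrm{id}+\mathrm{id}\,\widehat\otimes\,d$,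 whose second term carries the sign $(-1)^{i}$ on $T_i\otimes_A T_j$. Let $\widehat\Delta:T\to T\widehat\otimes_A T$ be a diagonal approximation, i.e. a chain map of complexes of bimodules with $(\varepsilon\widehat\otimes_A\varepsilon)\widehat\Delta=\varepsilon$ (where $A\otimes_A A=A$). Let $$\smile:\widehat H^{r}(A,M)\otimes\widehat H^{s}(A,M')\to\widehat H^{r+s}(A,M\otimes_A M'),\qquad \frown:\widehat H^{r}(A,M)\otimes\widehat H_{n}(A,M')\to\widehat H_{n-r}(A,M\otimes_A M')$$ be the cup product, induced by $u\smile v=(u\,\widehat\otimes_A v)\widehat\Delta$ with $(u\,\widehat\otimes_A v)(x\otimes y)=(-1)^{|v||x|}u(x)\otimes v(y)$, and the cap product, induced by $\widehat\Delta\otimes_{A^{e}}\mathrm{id}$ followed by $u\otimes\big((x\otimes y)\otimes_{A^{e}}m\big)\mapsto(-1)^{|u||x|}x\otimes_{A^{e}}(u(y)\otimes_A m)$. Then for all $A$-bimodules $L,M,N$, all $r,s,n\in\mathbb Z$ and all $\alpha\in\widehat H^{r}(A,L)$, $\beta\in\widehat H^{s}(A,M)$, $\omega\in\widehat H_{n}(A,N)$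 we have $$(\alpha\smile\beta)\frown\omega=\alpha\frown(\beta\frown\omega)$$ in $\widehat H_{n-r-s}(A,L\otimes_A M\otimes_A N)$, where $(L\otimes_A M)\otimes_A N$ and $L\otimes_A(M\otimes_A N)$ are identified in the canonical way. -/

import Mathlib

open CategoryTheory TensorProduct MulOpposite
open scoped ModuleCat

universe u w v v₁ v₂ v₃

namespace TateHochschild

/-! ### Bimodules

An `A`-bimodule (with central action of `k`) is a left module over the enveloping algebra
`A ⊗[k] Aᵐᵒᵖ`, where `(a ⊗ b°) • m = a m b`. -/

/-- The enveloping algebra `Aᵉ = A ⊗ A°`. -/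
abbrev Env (k : Type u) (A : Type w) [Field k] [Ring A] [Algebra k A] : Type w :=
  A ⊗[k] Aᵐᵒᵖ

/-- A finite dimensional `k`-algebra is Frobenius if it carries a non-degenerate bilinear form
with `⟨ab, c⟩ = ⟨a, bc⟩`. -/
def IsFrobeniusAlgebra (k : Type u) (A : Type w) [Field k] [Ring A] [Algebra k A] : Prop :=
  Module.Finite k A ∧ ∃ B : LinearMap.BilinForm k A, B.Nondegenerate ∧
    ∀ a b c : A, B (a * b) c = B a (b * c)

section Bimodule

variable (k : Type u) {A : Type w} [Field k] [Ring A] [Algebra k A]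

/-- `A` as a bimodule over itself: `(a ⊗ b°) • x = a x b`. -/
instance selfModule : Module (Env k A) A := instModuleTensorProductMop k A

theorem self_smul (a b x : A) : ((a ⊗ₜ[k] op b : Env k A) • x : A) = a * x * b := by
  change TensorProduct.Algebra.moduleAux _ _ = _
  simp [TensorProduct.Algebra.moduleAux, ← mul_assoc]

instance selfTower : IsScalarTower k (Env k A) A where
  smul_assoc r e x := by
    change TensorProduct.Algebra.moduleAux _ _ = _ • TensorProduct.Algebra.moduleAux _ _
    simp

variable {X : Type v₁} [AddCommGroup X] [Module k X] [Module (Env k A) X]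
  [IsScalarTower k (Env k A) X]

/-- The left action `a x` on a bimodule. -/
def lact (a : A) : X →ₗ[k] X := Algebra.lsmul k k X (a ⊗ₜ[k] (1 : Aᵐᵒᵖ) : Env k A)

/-- The right action `x b` on a bimodule. -/
def ract (b : A) : X →ₗ[k] X := Algebra.lsmul k k X ((1 : A) ⊗ₜ[k] op b : Env k A)

theorem lact_apply (a : A) (x : X) :
    lact k a x = (a ⊗ₜ[k] (1 : Aᵐᵒᵖ) : Env k A) • x := rfl

theorem ract_apply (b : A) (x : X) :
    ract k b x = ((1 : A) ⊗ₜ[k] op b : Env k A) • x := rfl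

theorem lact_ract (a b : A) (x : X) :
    lact k a (ract k b x) = (a ⊗ₜ[k] op b : Env k A) • x := by
  simp [lact_apply, ract_apply, smul_smul]

theorem ract_lact (a b : A) (x : X) :
    ract k b (lact k a x) = (a ⊗ₜ[k] op b : Env k A) • x := by
  simp [lact_apply, ract_apply, smul_smul]

theorem lact_mul (a a' : A) (x : X) : lact k (a * a') x = lact k a (lact k a' x) := by
  simp [lact_apply, smul_smul]

theorem ract_mul (a a' : A) (x : X) : ract k (a * a') x = ract k a' (ract k a x) := by
  simp [ract_apply, smul_smul]

variable {Y : Type v₂} [AddCommGroup Y] [Module k Y] [Module (Env k A) Y]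
  [IsScalarTower k (Env k A) Y]

theorem map_lact (f : X →ₗ[Env k A] Y) (a : A) (x : X) : f (lact k a x) = lact k a (f x) :=
  map_smul f _ _

theorem map_ract (f : X →ₗ[Env k A] Y) (a : A) (x : X) : f (ract k a x) = ract k a (f x) :=
  map_smul f _ _

/-- A `k`-linear map compatible with both actions is a bimodule map. -/
def bimoduleHom (f : X →ₗ[k] Y)
    (hf : ∀ (a b : A) (x : X), f (lact k a (ract k b x)) = lact k a (ract k b (f x))) :
    X →ₗ[Env k A] Y where
  toFun := f
  map_add' := map_add f
  map_smul' e x := by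
    induction e using TensorProduct.induction_on with
    | zero =>
      exact (congrArg f (zero_smul (Env k A) x)).trans
        ((map_zero f).trans (zero_smul (Env k A) (f x)).symm)
    | add e₁ e₂ h₁ h₂ => simp only [add_smul, map_add, h₁, h₂, RingHom.id_apply]
    | tmul a b =>
      have := hf a b.unop x
      rw [lact_ract, lact_ract, op_unop] at this
      exact this

end Bimodule

/-! ### The tensor product `X ⊗_A Y` of bimodules -/

section BTensor

variable (k : Type u) (A : Type w) [Field k] [Ring A] [Algebra k A]
variable (X : Type v₁) [AddCommGroup X] [Module k X] [Module (Env k A) X]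
  [IsScalarTower k (Env k A) X]
variable (Y : Type v₂) [AddCommGroup Y] [Module k Y] [Module (Env k A) Y]
  [IsScalarTower k (Env k A) Y]

/-- The relations `x a ⊗ y - x ⊗ a y`. -/
def bRel : Submodule k (X ⊗[k] Y) :=
  Submodule.span k {z | ∃ (a : A) (x : X) (y : Y),
    z = (ract k a x) ⊗ₜ[k] y - x ⊗ₜ[k] (lact k a y)}

/-- The tensor product `X ⊗_A Y` of two `A`-bimodules. -/
def BTensor : Type (max v₁ v₂) := (X ⊗[k] Y) ⧸ bRel k A X Y

instance : AddCommGroup (BTensor k A X Y) := inferInstanceAs (AddCommGroup (_ ⧸ bRel k A X Y))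
instance : Module k (BTensor k A X Y) := inferInstanceAs (Module k (_ ⧸ bRel k A X Y))

variable {X Y}

/-- The class of `x ⊗ y` in `X ⊗_A Y`. -/
def bmk : X →ₗ[k] Y →ₗ[k] BTensor k A X Y :=
  (TensorProduct.mk k X Y).compr₂ (bRel k A X Y).mkQ

variable {A}

theorem bmk_balanced (a : A) (x : X) (y : Y) :
    bmk k A (ract k a x) y = bmk k A x (lact k a y) := by
  refine (Submodule.Quotient.eq _).2 (Submodule.subset_span ⟨a, x, y, rfl⟩)

variable {k}

theorem BTensor.induction {P : BTensor k A X Y → Prop} (h0 : P 0)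
    (h : ∀ x y, P (bmk k A x y)) (ha : ∀ z z', P z → P z' → P (z + z')) (z) : P z := by
  obtain ⟨z, rfl⟩ := (bRel k A X Y).mkQ_surjective z
  induction z using TensorProduct.induction_on with
  | zero => exact h0
  | tmul x y => exact h x y
  | add z z' hz hz' => rw [map_add]; exact ha _ _ hz hz'

variable {Z : Type v₃} [AddCommGroup Z] [Module k Z]

/-- The universal property of `X ⊗_A Y` for `k`-linear maps. -/
def BTensor.lift (f : X →ₗ[k] Y →ₗ[k] Z)
    (hf : ∀ (a : A) x y, f (ract k a x) y = f x (lact k a y)) : BTensor k A X Y →ₗ[k] Z :=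
  (bRel k A X Y).liftQ (TensorProduct.lift f) (by
    refine Submodule.span_le.2 ?_
    rintro _ ⟨a, x, y, rfl⟩
    simp [hf])

@[simp]
theorem BTensor.lift_bmk (f : X →ₗ[k] Y →ₗ[k] Z) (hf) (x : X) (y : Y) :
    BTensor.lift f hf (bmk k A x y) = f x y := by
  exact TensorProduct.lift.tmul x y

/-- The left action on `X ⊗_A Y`, `a (x ⊗ y) = a x ⊗ y`. -/
def bLeft : A →ₐ[k] Module.End k (BTensor k A X Y) :=
  AlgHom.ofLinearMap
    { toFun := fun a => BTensor.lift ((bmk k A).comp (lact k a)) (fun b x y => by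
        simp only [LinearMap.comp_apply]
        rw [← bmk_balanced, ract_lact, lact_ract])
      map_add' := fun a b => by
        ext z
        induction z using BTensor.induction with
        | h0 => simp
        | ha z z' h h' => simp only [map_add, h, h']
        | h x y => simp [lact_apply, TensorProduct.add_tmul, add_smul]
      map_smul' := fun c a => by
        ext z
        induction z using BTensor.induction with
        | h0 => simp
        | ha z z' h h' => simp only [map_add, h, h']
        | h x y => simp [lact_apply, ← TensorProduct.smul_tmul'] }
    (by
      ext z
      induction z using BTensor.induction with
      | h0 => simp
      | ha z z' h h' => simp only [map_add, h, h']
      | h x y => simp [lact_apply, ← Algebra.TensorProduct.one_def])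
    (fun a b => by
      ext z
      induction z using BTensor.induction with
      | h0 => simp
      | ha z z' h h' => simp only [map_add, h, h']
      | h x y => simp [lact_mul])

/-- The right action on `X ⊗_A Y`, `(x ⊗ y) b = x ⊗ y b`. -/
def bRight : Aᵐᵒᵖ →ₐ[k] Module.End k (BTensor k A X Y) :=
  AlgHom.ofLinearMap
    { toFun := fun a => BTensor.lift ((bmk k A).compl₂ (ract k a.unop)) (fun b x y => by
        simp only [LinearMap.compl₂_apply]
        rw [bmk_balanced, ract_lact, lact_ract])
      map_add' := fun a b => by
        ext z
        induction z using BTensor.induction with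
        | h0 => simp
        | ha z z' h h' => simp only [map_add, h, h']
        | h x y => simp [ract_apply, TensorProduct.tmul_add, add_smul]
      map_smul' := fun c a => by
        ext z
        induction z using BTensor.induction with
        | h0 => simp
        | ha z z' h h' => simp only [map_add, h, h']
        | h x y => simp [ract_apply] }
    (by
      ext z
      induction z using BTensor.induction with
      | h0 => simp
      | ha z z' h h' => simp only [map_add, h, h']
      | h x y => simp [ract_apply, ← Algebra.TensorProduct.one_def])
    (fun a b => by
      ext z
      induction z using BTensor.induction with
      | h0 => simp
      | ha z z' h h' => simp only [map_add, h, h']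
      | h x y => simp [ract_mul])

/-- The action of `Aᵉ` on `X ⊗_A Y`. -/
def bAct : Env k A →ₐ[k] Module.End k (BTensor k A X Y) :=
  Algebra.TensorProduct.lift bLeft bRight (fun a b => by
    ext z
    induction z using BTensor.induction with
    | h0 => simp
    | ha z z' h h' => simp only [map_add, h, h']
    | h x y => simp [bLeft, bRight])

/-- The bimodule structure of `X ⊗_A Y`, `a (x ⊗ y) b = a x ⊗ y b`. -/
instance : Module (Env k A) (BTensor k A X Y) :=
  Module.compHom (BTensor k A X Y) (bAct (k := k) (A := A) (X := X) (Y := Y)).toRingHom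

theorem smul_bmk (a b : A) (x : X) (y : Y) :
    (a ⊗ₜ[k] op b : Env k A) • bmk k A x y = bmk k A (lact k a x) (ract k b y) := by
  change bAct (a ⊗ₜ[k] op b) (bmk k A x y) = _
  simp [bAct, bLeft, bRight]

instance : IsScalarTower k (Env k A) (BTensor k A X Y) where
  smul_assoc r e z := by
    change bAct (r • e) z = r • bAct e z
    simp

theorem lact_bmk (a : A) (x : X) (y : Y) :
    lact k a (bmk k A x y) = bmk k A (lact k a x) y := by
  rw [lact_apply, ← op_one, smul_bmk, ract_apply, op_one, ← Algebra.TensorProduct.one_def, one_smul]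

theorem ract_bmk (b : A) (x : X) (y : Y) :
    ract k b (bmk k A x y) = bmk k A x (ract k b y) := by
  rw [ract_apply, smul_bmk, lact_apply, ← Algebra.TensorProduct.one_def, one_smul]

theorem BTensor.hom_ext {W : Type v₃} [AddCommGroup W] [Module (Env k A) W]
    {f g : BTensor k A X Y →ₗ[Env k A] W}
    (h : ∀ x y, f (bmk k A x y) = g (bmk k A x y)) : f = g := by
  ext z
  induction z using BTensor.induction with
  | h0 => simp
  | ha z z' h h' => simp only [map_add, h, h']
  | h x y => exact h x y

section
variable [Module (Env k A) Z] [IsScalarTower k (Env k A) Z]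

/-- The universal property of `X ⊗_A Y` for bimodule maps. -/
def BTensor.liftE (f : X →ₗ[k] Y →ₗ[k] Z)
    (hf : ∀ (a : A) x y, f (ract k a x) y = f x (lact k a y))
    (hl : ∀ (a b : A) x y, f (lact k a x) (ract k b y) = lact k a (ract k b (f x y))) :
    BTensor k A X Y →ₗ[Env k A] Z :=
  bimoduleHom k (BTensor.lift f hf) (fun a b z => by
    induction z using BTensor.induction with
    | h0 => simp
    | ha z z' h h' => simp only [map_add, h, h']
    | h x y => rw [ract_bmk, lact_bmk, lift_bmk, lift_bmk, hl])

@[simp]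
theorem BTensor.liftE_bmk (f : X →ₗ[k] Y →ₗ[k] Z) (hf) (hl) (x : X) (y : Y) :
    BTensor.liftE (A := A) f hf hl (bmk k A x y) = f x y :=
  BTensor.lift_bmk (A := A) f hf x y

end

end BTensor

section BTensorMaps

variable {k : Type u} {A : Type w} [Field k] [Ring A] [Algebra k A]
variable {X : Type*} [AddCommGroup X] [Module k X] [Module (Env k A) X]
  [IsScalarTower k (Env k A) X]
variable {X' : Type*} [AddCommGroup X'] [Module k X'] [Module (Env k A) X']
  [IsScalarTower k (Env k A) X']
variable {Y : Type*} [AddCommGroup Y] [Module k Y] [Module (Env k A) Y]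
  [IsScalarTower k (Env k A) Y]
variable {Y' : Type*} [AddCommGroup Y'] [Module k Y'] [Module (Env k A) Y']
  [IsScalarTower k (Env k A) Y']
variable {Z : Type*} [AddCommGroup Z] [Module k Z] [Module (Env k A) Z]
  [IsScalarTower k (Env k A) Z]

/-- `f ⊗_A g` for bimodule maps `f` and `g` (no sign). -/
def BTensor.map (f : X →ₗ[Env k A] X') (g : Y →ₗ[Env k A] Y') :
    BTensor k A X Y →ₗ[Env k A] BTensor k A X' Y' :=
  BTensor.liftE ((bmk k A).compl₁₂ (f.restrictScalars k) (g.restrictScalars k))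
    (fun a x y => by simp [map_lact, map_ract, bmk_balanced])
    (fun a b x y => by simp [map_lact, map_ract, lact_bmk, ract_bmk])

@[simp]
theorem BTensor.map_bmk (f : X →ₗ[Env k A] X') (g : Y →ₗ[Env k A] Y') (x : X) (y : Y) :
    BTensor.map f g (bmk k A x y) = bmk k A (f x) (g y) := by
  simp [BTensor.map]

/-- The multiplication isomorphism `A ⊗_A A → A`, `a ⊗ b ↦ a b`. -/
def BTensor.mul : BTensor k A A A →ₗ[Env k A] A :=
  BTensor.liftE (LinearMap.mul k A)
    (fun a x y => by
      rw [ract_apply, lact_apply, ← op_one, self_smul, self_smul]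
      simp [mul_assoc])
    (fun a b x y => by
      rw [lact_ract, self_smul, ract_apply, lact_apply, ← op_one, self_smul, self_smul]
      simp [mul_assoc])

/-- The associativity map `(X ⊗_A Y) ⊗_A Z → X ⊗_A (Y ⊗_A Z)`. -/
def BTensor.assocHom :
    BTensor k A (BTensor k A X Y) Z →ₗ[Env k A] BTensor k A X (BTensor k A Y Z) :=
  BTensor.liftE
    (BTensor.lift
      (LinearMap.mk₂ k (fun x y => (bmk k A x).comp (bmk k A y))
        (fun _ _ _ => by ext; simp) (fun _ _ _ => by ext; simp)
        (fun _ _ _ => by ext; simp) (fun _ _ _ => by ext; simp))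
      (fun a x y => by ext z; simp [bmk_balanced, lact_bmk]))
    (fun a t z => by
      induction t using BTensor.induction with
      | h0 => simp
      | ha t t' h h' => simp only [map_add, LinearMap.add_apply, h, h']
      | h x y => simp [ract_bmk, bmk_balanced])
    (fun a b t z => by
      induction t using BTensor.induction with
      | h0 => simp
      | ha t t' h h' => simp only [map_add, LinearMap.add_apply, h, h']
      | h x y => simp [ract_bmk, lact_bmk])

@[simp]
theorem BTensor.assocHom_bmk (x : X) (y : Y) (z : Z) :
    BTensor.assocHom (bmk k A (bmk k A x y) z) = bmk k A x (bmk k A y z) := by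
  simp [BTensor.assocHom]

/-- The inverse associativity map. -/
def BTensor.assocInv :
    BTensor k A X (BTensor k A Y Z) →ₗ[Env k A] BTensor k A (BTensor k A X Y) Z :=
  BTensor.liftE
    (LinearMap.flip (BTensor.lift
      (LinearMap.mk₂ k (fun y z => ((bmk k A).flip z).comp ((bmk k A).flip y))
        (fun _ _ _ => by ext; simp) (fun _ _ _ => by ext; simp)
        (fun _ _ _ => by ext; simp) (fun _ _ _ => by ext; simp))
      (fun a y z => by ext x; simp [← bmk_balanced, ract_bmk])))
    (fun a x t => by
      induction t using BTensor.induction with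
      | h0 => simp
      | ha t t' h h' => simp only [map_add, h, h']
      | h y z => simp [lact_bmk, bmk_balanced])
    (fun a b x t => by
      induction t using BTensor.induction with
      | h0 => simp
      | ha t t' h h' => simp only [map_add, h, h']
      | h y z => simp [ract_bmk, lact_bmk])

@[simp]
theorem BTensor.assocInv_bmk (x : X) (y : Y) (z : Z) :
    BTensor.assocInv (bmk k A x (bmk k A y z)) = bmk k A (bmk k A x y) z := by
  simp [BTensor.assocInv]

/-- The canonical isomorphism `(X ⊗_A Y) ⊗_A Z ≅ X ⊗_A (Y ⊗_A Z)` of bimodules. -/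
def BTensor.assoc :
    BTensor k A (BTensor k A X Y) Z ≃ₗ[Env k A] BTensor k A X (BTensor k A Y Z) :=
  LinearEquiv.ofLinearMap BTensor.assocHom BTensor.assocInv
    (BTensor.hom_ext fun x t => by
      induction t using BTensor.induction with
      | h0 => simp
      | ha t t' h h' => simp only [map_add, h, h']
      | h y z => simp)
    (BTensor.hom_ext fun t z => by
      induction t using BTensor.induction with
      | h0 => simp
      | ha t t' h h' => simp only [map_add, LinearMap.add_apply, h, h']
      | h x y => simp)

end BTensorMaps

/-! ### The tensor product `X ⊗_{Aᵉ} Y` -/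

section ETensor

variable (k : Type u) (A : Type w) [Field k] [Ring A] [Algebra k A]
variable (X : Type v₁) [AddCommGroup X] [Module k X] [Module (Env k A) X]
  [IsScalarTower k (Env k A) X]
variable (Y : Type v₂) [AddCommGroup Y] [Module k Y] [Module (Env k A) Y]
  [IsScalarTower k (Env k A) Y]

/-- The relations `b x a ⊗ y - x ⊗ a y b`, that is `x · (a ⊗ b°) ⊗ y - x ⊗ (a ⊗ b°) · y` for the
right `Aᵉ`-module structure `x · (a ⊗ b°) = b x a` of a bimodule. -/
def eRel : Submodule k (X ⊗[k] Y) :=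
  Submodule.span k {z | ∃ (a b : A) (x : X) (y : Y),
    z = (lact k b (ract k a x)) ⊗ₜ[k] y - x ⊗ₜ[k] (lact k a (ract k b y))}

/-- The tensor product `X ⊗_{Aᵉ} Y` of two bimodules, `X` being regarded as a right
`Aᵉ`-module and `Y` as a left one. -/
def ETensor : Type (max v₁ v₂) := (X ⊗[k] Y) ⧸ eRel k A X Y

instance : AddCommGroup (ETensor k A X Y) := inferInstanceAs (AddCommGroup (_ ⧸ eRel k A X Y))
instance : Module k (ETensor k A X Y) := inferInstanceAs (Module k (_ ⧸ eRel k A X Y))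

variable {X Y}

/-- The class of `x ⊗ y` in `X ⊗_{Aᵉ} Y`. -/
def emk : X →ₗ[k] Y →ₗ[k] ETensor k A X Y :=
  (TensorProduct.mk k X Y).compr₂ (eRel k A X Y).mkQ

variable {A}

theorem emk_balanced (a b : A) (x : X) (y : Y) :
    emk k A (lact k b (ract k a x)) y = emk k A x (lact k a (ract k b y)) := by
  refine (Submodule.Quotient.eq _).2 (Submodule.subset_span ⟨a, b, x, y, rfl⟩)

variable {k}

theorem ETensor.induction {P : ETensor k A X Y → Prop} (h0 : P 0)
    (h : ∀ x y, P (emk k A x y)) (ha : ∀ z z', P z → P z' → P (z + z')) (z) : P z := by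
  obtain ⟨z, rfl⟩ := (eRel k A X Y).mkQ_surjective z
  induction z using TensorProduct.induction_on with
  | zero => exact h0
  | tmul x y => exact h x y
  | add z z' hz hz' => rw [map_add]; exact ha _ _ hz hz'

variable {Z : Type v₃} [AddCommGroup Z] [Module k Z]

/-- The universal property of `X ⊗_{Aᵉ} Y`. -/
def ETensor.lift (f : X →ₗ[k] Y →ₗ[k] Z)
    (hf : ∀ (a b : A) x y,
      f (lact k b (ract k a x)) y = f x (lact k a (ract k b y))) : ETensor k A X Y →ₗ[k] Z :=
  (eRel k A X Y).liftQ (TensorProduct.lift f) (by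
    refine Submodule.span_le.2 ?_
    rintro _ ⟨a, b, x, y, rfl⟩
    simp [hf])

@[simp]
theorem ETensor.lift_emk (f : X →ₗ[k] Y →ₗ[k] Z) (hf) (x : X) (y : Y) :
    ETensor.lift f hf (emk k A x y) = f x y := by
  exact TensorProduct.lift.tmul x y

theorem ETensor.hom_ext {f g : ETensor k A X Y →ₗ[k] Z}
    (h : ∀ x y, f (emk k A x y) = g (emk k A x y)) : f = g := by
  ext z
  induction z using ETensor.induction with
  | h0 => simp
  | ha z z' h h' => simp only [map_add, h, h']
  | h x y => exact h x y

end ETensor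

section ETensorMaps

variable {k : Type u} {A : Type w} [Field k] [Ring A] [Algebra k A]
variable {X : Type*} [AddCommGroup X] [Module k X] [Module (Env k A) X]
  [IsScalarTower k (Env k A) X]
variable {X' : Type*} [AddCommGroup X'] [Module k X'] [Module (Env k A) X']
  [IsScalarTower k (Env k A) X']
variable {Y : Type*} [AddCommGroup Y] [Module k Y] [Module (Env k A) Y]
  [IsScalarTower k (Env k A) Y]
variable {Y' : Type*} [AddCommGroup Y'] [Module k Y'] [Module (Env k A) Y']
  [IsScalarTower k (Env k A) Y']
variable {Z : Type*} [AddCommGroup Z] [Module k Z] [Module (Env k A) Z]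
  [IsScalarTower k (Env k A) Z]

/-- `f ⊗_{Aᵉ} g` for bimodule maps `f` and `g` (no sign). -/
def ETensor.map (f : X →ₗ[Env k A] X') (g : Y →ₗ[Env k A] Y') :
    ETensor k A X Y →ₗ[k] ETensor k A X' Y' :=
  ETensor.lift ((emk k A).compl₁₂ (f.restrictScalars k) (g.restrictScalars k))
    (fun a b x y => by simp [map_lact, map_ract, emk_balanced])

@[simp]
theorem ETensor.map_emk (f : X →ₗ[Env k A] X') (g : Y →ₗ[Env k A] Y') (x : X) (y : Y) :
    ETensor.map f g (emk k A x y) = emk k A (f x) (g y) := by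
  simp [ETensor.map]

/-- The canonical map `(X ⊗_A Y) ⊗_{Aᵉ} Z → X ⊗_{Aᵉ} (Y ⊗_A Z)`,
`(x ⊗ y) ⊗ z ↦ x ⊗ (y ⊗ z)` (it is an isomorphism). -/
def ETensor.assocHom :
    ETensor k A (BTensor k A X Y) Z →ₗ[k] ETensor k A X (BTensor k A Y Z) :=
  ETensor.lift
    (BTensor.lift
      (LinearMap.mk₂ k (fun x y => (emk k A x).comp (bmk k A y))
        (fun _ _ _ => by ext; simp) (fun _ _ _ => by ext; simp)
        (fun _ _ _ => by ext; simp) (fun _ _ _ => by ext; simp))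
      (fun a x y => by
        ext z
        have := emk_balanced k a 1 x (bmk k A y z)
        rw [lact_apply k 1, ract_apply k 1, op_one, ← Algebra.TensorProduct.one_def, one_smul,
          one_smul, lact_bmk] at this
        simpa using this))
    (fun a b t z => by
      induction t using BTensor.induction with
      | h0 => simp
      | ha t t' h h' => simp only [map_add, LinearMap.add_apply, h, h']
      | h x y =>
        have := emk_balanced k 1 b x (bmk k A (ract k a y) z)
        rw [lact_apply k 1, ract_apply k 1, op_one, ← Algebra.TensorProduct.one_def, one_smul,
          one_smul, ract_bmk] at this
        simpa [ract_bmk, lact_bmk, bmk_balanced] using this)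

@[simp]
theorem ETensor.assocHom_emk (x : X) (y : Y) (z : Z) :
    ETensor.assocHom (emk k A (bmk k A x y) z) = emk k A x (bmk k A y z) := by
  simp [ETensor.assocHom]

end ETensorMaps

/-! ### Complete resolutions -/

section Complexes

variable {k : Type u} {A : Type w} [Field k] [Ring A] [Algebra k A]

/-- Precomposition `Hom_{Aᵉ}(Y, M) → Hom_{Aᵉ}(X, M)` with a bimodule map `X → Y`. -/
def precomp {X : Type*} [AddCommGroup X] [Module (Env k A) X]
    {Y : Type*} [AddCommGroup Y] [Module (Env k A) Y] (f : X →ₗ[Env k A] Y)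
    (M : Type*) [AddCommGroup M] [Module k M] [Module (Env k A) M] [IsScalarTower k (Env k A) M] :
    (Y →ₗ[Env k A] M) →ₗ[k] (X →ₗ[Env k A] M) where
  toFun g := g ∘ₗ f
  map_add' _ _ := rfl
  map_smul' _ _ := rfl

variable (k A) in
/-- A complete resolution `T → A` of `A` over `Aᵉ`: an acyclic complex of finitely generated
projective bimodules whose `Aᵉ`-dual is acyclic, together with an augmentation, that is
a surjection `ε : T₀ → A` such that `⋯ → T₁ → T₀ → A → 0` is exact (so the non-negative
truncation of `T` is a projective resolution of `A`). -/
structure CompleteResolution where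
  /-- the underlying complex `T` -/
  cx : ChainComplex (ModuleCat.{v} (Env k A)) ℤ
  finite : ∀ i, Module.Finite (Env k A) (cx.X i)
  projective : ∀ i, Module.Projective (Env k A) (cx.X i)
  exact : ∀ i, Function.Exact (cx.d (i + 1) i).hom (cx.d i (i - 1)).hom
  dual_exact : ∀ i, Function.Exact
    (precomp (cx.d i (i - 1)).hom (Env k A)) (precomp (cx.d (i + 1) i).hom (Env k A))
  /-- the augmentation `ε` -/
  ε : cx.X 0 →ₗ[Env k A] A
  ε_surjective : Function.Surjective ε
  ε_exact : Function.Exact (cx.d 1 0).hom ε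

/-! ### The complete tensor product of complexes -/

/-- The differential of the complete tensor product,
`(x_{ij}) ↦ d x_{i+1,j} + (-1)^i d x_{i,j+1}` in the component `(i, j)`. -/
def completeTensorD (C C' : ChainComplex (ModuleCat.{v} (Env k A)) ℤ) (n m : ℤ) :
    ((p : {p : ℤ × ℤ // p.1 + p.2 = n}) → BTensor k A (C.X p.1.1) (C'.X p.1.2)) →ₗ[Env k A]
      ((p : {p : ℤ × ℤ // p.1 + p.2 = m}) → BTensor k A (C.X p.1.1) (C'.X p.1.2)) :=
  if h : m + 1 = n then
    LinearMap.pi fun p =>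
      BTensor.map (C.d (p.1.1 + 1) p.1.1).hom LinearMap.id ∘ₗ
          LinearMap.proj (R := Env k A)
            (φ := fun p : {p : ℤ × ℤ // p.1 + p.2 = n} =>
              BTensor k A (C.X p.1.1) (C'.X p.1.2))
            ⟨(p.1.1 + 1, p.1.2), by have := p.2; dsimp only; omega⟩ +
        (p.1.1.negOnePow : ℤ) •
          BTensor.map LinearMap.id (C'.d (p.1.2 + 1) p.1.2).hom ∘ₗ
          LinearMap.proj (R := Env k A)
            (φ := fun p : {p : ℤ × ℤ // p.1 + p.2 = n} =>
              BTensor k A (C.X p.1.1) (C'.X p.1.2))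
            ⟨(p.1.1, p.1.2 + 1), by have := p.2; dsimp only; omega⟩
  else 0

theorem completeTensorD_apply (C C' : ChainComplex (ModuleCat.{v} (Env k A)) ℤ) (n m i j : ℤ)
    (h : m + 1 = n) (hij : i + j = m) (x) :
    completeTensorD C C' n m x ⟨(i, j), hij⟩ =
      BTensor.map (C.d (i + 1) i).hom LinearMap.id (x ⟨(i + 1, j), by dsimp only; omega⟩) +
        (i.negOnePow : ℤ) •
          BTensor.map LinearMap.id (C'.d (j + 1) j).hom
            (x ⟨(i, j + 1), by dsimp only; omega⟩) := by
  simp [completeTensorD, h]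

theorem BTensor.map_map {X X' X'' Y Y' Y'' : Type*}
    [AddCommGroup X] [Module k X] [Module (Env k A) X] [IsScalarTower k (Env k A) X]
    [AddCommGroup X'] [Module k X'] [Module (Env k A) X'] [IsScalarTower k (Env k A) X']
    [AddCommGroup X''] [Module k X''] [Module (Env k A) X''] [IsScalarTower k (Env k A) X'']
    [AddCommGroup Y] [Module k Y] [Module (Env k A) Y] [IsScalarTower k (Env k A) Y]
    [AddCommGroup Y'] [Module k Y'] [Module (Env k A) Y'] [IsScalarTower k (Env k A) Y']
    [AddCommGroup Y''] [Module k Y''] [Module (Env k A) Y''] [IsScalarTower k (Env k A) Y'']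
    (f : X →ₗ[Env k A] X') (f' : X' →ₗ[Env k A] X'')
    (g : Y →ₗ[Env k A] Y') (g' : Y' →ₗ[Env k A] Y'') (z : BTensor k A X Y) :
    BTensor.map f' g' (BTensor.map f g z) = BTensor.map (f' ∘ₗ f) (g' ∘ₗ g) z := by
  induction z using BTensor.induction with
  | h0 => simp
  | ha z z' h h' => simp only [map_add, h, h']
  | h x y => simp

section
variable {X X' Y Y' : Type*}
    [AddCommGroup X] [Module k X] [Module (Env k A) X] [IsScalarTower k (Env k A) X]
    [AddCommGroup X'] [Module k X'] [Module (Env k A) X'] [IsScalarTower k (Env k A) X']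
    [AddCommGroup Y] [Module k Y] [Module (Env k A) Y] [IsScalarTower k (Env k A) Y]
    [AddCommGroup Y'] [Module k Y'] [Module (Env k A) Y'] [IsScalarTower k (Env k A) Y']

theorem BTensor.map_zero_left (g : Y →ₗ[Env k A] Y') (z : BTensor k A X Y) :
    BTensor.map (0 : X →ₗ[Env k A] X') g z = 0 := by
  induction z using BTensor.induction with
  | h0 => simp
  | ha z z' h h' => simp only [map_add, h, h', add_zero]
  | h x y => simp

theorem BTensor.map_zero_right (f : X →ₗ[Env k A] X') (z : BTensor k A X Y) :
    BTensor.map f (0 : Y →ₗ[Env k A] Y') z = 0 := by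
  induction z using BTensor.induction with
  | h0 => simp
  | ha z z' h h' => simp only [map_add, h, h', add_zero]
  | h x y => simp

end

theorem d_comp_d_hom (C : ChainComplex (ModuleCat.{v} (Env k A)) ℤ) (i j l : ℤ) :
    (C.d j l).hom ∘ₗ (C.d i j).hom = 0 := by
  rw [← ModuleCat.hom_comp, C.d_comp_d]; rfl

/-- The complete tensor product `C ⊗̂_A C'`, with components `∏_{i + j = n} C_i ⊗_A C'_j`. -/
def completeTensor (C C' : ChainComplex (ModuleCat.{v} (Env k A)) ℤ) :
    ChainComplex (ModuleCat.{v} (Env k A)) ℤ where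
  X n := ModuleCat.of (Env k A)
    ((p : {p : ℤ × ℤ // p.1 + p.2 = n}) → BTensor k A (C.X p.1.1) (C'.X p.1.2))
  d n m := ModuleCat.ofHom (completeTensorD C C' n m)
  shape n m h := by
    have h' : ¬ m + 1 = n := h
    simp only [completeTensorD, dif_neg h']
    rfl
  d_comp_d' n m l h h' := by
    have h₁ : m + 1 = n := h
    have h₂ : l + 1 = m := h'
    ext x ⟨⟨i, j⟩, hij⟩
    change completeTensorD C C' m l (completeTensorD C C' n m x) ⟨(i, j), hij⟩ = 0
    rw [completeTensorD_apply C C' m l i j h₂ hij, completeTensorD_apply C C' n m _ _ h₁,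
      completeTensorD_apply C C' n m _ _ h₁]
    simp only [map_add, map_neg, map_zsmul, BTensor.map_map, d_comp_d_hom, LinearMap.id_comp,
      LinearMap.comp_id, BTensor.map_zero_left, BTensor.map_zero_right, smul_zero, zero_add,
      add_zero, Int.negOnePow_succ, Units.val_neg, neg_smul, neg_add_cancel]

/-- The component `T_n → C_i ⊗_A C'_j` (`i + j = n`) of a map `T → C ⊗̂_A C'`. -/
def component {T C C' : ChainComplex (ModuleCat.{v} (Env k A)) ℤ} (Δ : T ⟶ completeTensor C C')
    (i j n : ℤ) (h : i + j = n) : T.X n →ₗ[Env k A] BTensor k A (C.X i) (C'.X j) :=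
  LinearMap.proj (R := Env k A)
    (φ := fun p : {p : ℤ × ℤ // p.1 + p.2 = n} => BTensor k A (C.X p.1.1) (C'.X p.1.2))
    ⟨(i, j), h⟩ ∘ₗ (Δ.f n).hom

theorem component_d {T C C' : ChainComplex (ModuleCat.{v} (Env k A)) ℤ}
    (Δ : T ⟶ completeTensor C C') (i j n m : ℤ) (h : m + 1 = n) (hij : i + j = m)
    (i' j' : ℤ) (hi : i + 1 = i') (hj : j + 1 = j') (x : T.X n) :
    component Δ i j m hij ((T.d n m).hom x) =
      BTensor.map (C.d i' i).hom LinearMap.id (component Δ i' j n (by omega) x) +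
        (i.negOnePow : ℤ) • BTensor.map LinearMap.id (C'.d j' j).hom
          (component Δ i j' n (by omega) x) := by
  subst hi hj
  have e := congrArg (fun f => f.hom x) (Δ.comm n m)
  have e' := congrFun e ⟨(i, j), hij⟩
  refine Eq.trans e'.symm ?_
  exact completeTensorD_apply C C' n m i j h hij _

/-- A diagonal approximation: a chain map `Δ : T → T ⊗̂_A T` with `(ε ⊗̂ ε) Δ = ε`, where
`A ⊗_A A` is identified with `A` and `A` is a complex concentrated in degree `0`. -/
def IsDiagonalApproximation (T : CompleteResolution.{u, w, v} k A)
    (Δ : T.cx ⟶ completeTensor T.cx T.cx) : Prop :=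
  BTensor.mul ∘ₗ BTensor.map T.ε T.ε ∘ₗ component Δ 0 0 0 (add_zero 0) = T.ε

end Complexes

/-! ### Tate-Hochschild cohomology and homology -/

section SubQuot

variable {k : Type u} [Field k]
variable {V : Type*} [AddCommGroup V] [Module k V]
variable {W : Type*} [AddCommGroup W] [Module k W]
variable {U : Type*} [AddCommGroup U] [Module k U]

/-- The quotient `Z / B` of cycles modulo boundaries (used for `B ≤ Z`). -/
abbrev SubQuot (Z B : Submodule k V) : Type _ := Z ⧸ B.submoduleOf Z

/-- The class in `Z / B` of a cycle. -/
def SubQuot.mk (Z B : Submodule k V) : Z →ₗ[k] SubQuot Z B := (B.submoduleOf Z).mkQ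

/-- The map induced on `Z / B`. -/
def SubQuot.map {ZV BV : Submodule k V} {ZW BW : Submodule k W} (f : V →ₗ[k] W)
    (hZ : ∀ v ∈ ZV, f v ∈ ZW) (hB : ∀ v ∈ BV, f v ∈ BW) : SubQuot ZV BV →ₗ[k] SubQuot ZW BW :=
  Submodule.mapQ _ _ (f.restrict hZ) (fun v hv => hB v.1 hv)

/-- The bilinear map induced on `Z / B`. -/
def SubQuot.map₂ {ZV BV : Submodule k V} {ZW BW : Submodule k W} {ZU BU : Submodule k U}
    (f : V →ₗ[k] W →ₗ[k] U) (hZ : ∀ v ∈ ZV, ∀ w ∈ ZW, f v w ∈ ZU)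
    (hl : ∀ v ∈ BV, ∀ w ∈ ZW, f v w ∈ BU) (hr : ∀ v ∈ ZV, ∀ w ∈ BW, f v w ∈ BU) :
    SubQuot ZV BV →ₗ[k] SubQuot ZW BW →ₗ[k] SubQuot ZU BU :=
  Submodule.liftQ _
    { toFun := fun v => SubQuot.map (f v.1) (hZ v.1 v.2) (hr v.1 v.2)
      map_add' := fun v v' => by
        ext w
        change SubQuot.mk ZU BU _ = SubQuot.mk ZU BU _ + SubQuot.mk ZU BU _
        rw [← map_add]
        congr 1
        ext
        simp
      map_smul' := fun c v => by
        ext w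
        change SubQuot.mk ZU BU _ = c • SubQuot.mk ZU BU _
        rw [← map_smul]
        congr 1
        ext
        simp }
    (fun v hv => by
      rw [LinearMap.mem_ker]
      ext w
      exact (Submodule.Quotient.mk_eq_zero _).2 (hl v.1 hv w.1 w.2))

end SubQuot

section Tate

variable {k : Type u} {A : Type w} [Field k] [Ring A] [Algebra k A]
variable (T : ChainComplex (ModuleCat.{v} (Env k A)) ℤ)
variable (M : Type v₁) [AddCommGroup M] [Module k M] [Module (Env k A) M]
  [IsScalarTower k (Env k A) M]
variable (N : Type v₂) [AddCommGroup N] [Module k N] [Module (Env k A) N]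
  [IsScalarTower k (Env k A) N]

/-- The `n`-cocycles of `Hom_{Aᵉ}(T, M)`. (A sign in its differential does not matter.) -/
def cocycles (n : ℤ) : Submodule k (T.X n →ₗ[Env k A] M) :=
  LinearMap.ker (precomp (T.d (n + 1) n).hom M)

/-- The `n`-coboundaries of `Hom_{Aᵉ}(T, M)`. -/
def coboundaries (n : ℤ) : Submodule k (T.X n →ₗ[Env k A] M) :=
  LinearMap.range (precomp (T.d n (n - 1)).hom M)

/-- The cohomology `Hⁿ(Hom_{Aᵉ}(T, M))`, that is the Tate-Hochschild cohomology `Ĥⁿ(A, M)` if `T`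
is a complete resolution of `A`. -/
abbrev TateCohomology (n : ℤ) : Type _ := SubQuot (cocycles T M n) (coboundaries T M n)

/-- The `n`-cycles of `T ⊗_{Aᵉ} N`. -/
def cycles (n : ℤ) : Submodule k (ETensor k A (T.X n) N) :=
  LinearMap.ker (ETensor.map (T.d n (n - 1)).hom LinearMap.id)

/-- The `n`-boundaries of `T ⊗_{Aᵉ} N`. -/
def boundaries (n : ℤ) : Submodule k (ETensor k A (T.X n) N) :=
  LinearMap.range (ETensor.map (T.d (n + 1) n).hom LinearMap.id)

/-- The homology `H_n(T ⊗_{Aᵉ} N)`, that is the Tate-Hochschild homology `Ĥ_n(A, N)` if `T`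
is a complete resolution of `A`. -/
abbrev TateHomology (n : ℤ) : Type _ := SubQuot (cycles T N n) (boundaries T N n)

variable {T M N}

/-- The map `Ĥ_n(A, M) → Ĥ_n(A, N)` induced by a bimodule map `M → N`. -/
def TateHomology.map (f : M →ₗ[Env k A] N) (n : ℤ) :
    TateHomology T M n →ₗ[k] TateHomology T N n :=
  SubQuot.map (ETensor.map LinearMap.id f)
    (fun z hz => by
      rw [cycles, LinearMap.mem_ker] at hz ⊢
      have : ∀ z : ETensor k A (T.X n) M,
          ETensor.map (T.d n (n - 1)).hom LinearMap.id (ETensor.map LinearMap.id f z) =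
          ETensor.map LinearMap.id f (ETensor.map (T.d n (n - 1)).hom LinearMap.id z) := by
        intro z
        induction z using ETensor.induction with
        | h0 => simp
        | ha z z' h h' => simp only [map_add, h, h']
        | h x y => simp
      rw [this, hz, map_zero])
    (fun z hz => by
      obtain ⟨t, rfl⟩ := hz
      refine ⟨ETensor.map LinearMap.id f t, ?_⟩
      induction t using ETensor.induction with
      | h0 => simp
      | ha z z' h h' => simp only [map_add, h, h']
      | h x y => simp)

/-! ### Cup and cap products -/

variable (Δ : T ⟶ completeTensor T T)

/-- The cup product of cochains `u : T_r → M` and `v : T_s → N`, `u ⌣ v = (u ⊗̂ v) Δ` where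
`(u ⊗̂ v)(x ⊗ y) = (-1)^{|v||x|} u(x) ⊗ v(y)`. -/
def cochainCup (r s m : ℤ) (h : r + s = m) :
    (T.X r →ₗ[Env k A] M) →ₗ[k] (T.X s →ₗ[Env k A] N) →ₗ[k]
      (T.X m →ₗ[Env k A] BTensor k A M N) :=
  LinearMap.mk₂ k
    (fun u v => ((s * r).negOnePow : ℤ) • (BTensor.map u v ∘ₗ component Δ r s m h))
    (fun u u' v => by
      rw [← smul_add, ← LinearMap.add_comp]
      congr 2
      exact BTensor.hom_ext fun x y => by simp)
    (fun c u v => by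
      have e : BTensor.map (c • u) v = c • BTensor.map u v :=
        BTensor.hom_ext fun x y => by simp
      rw [e, LinearMap.smul_comp, smul_comm])
    (fun u v v' => by
      rw [← smul_add, ← LinearMap.add_comp]
      congr 2
      exact BTensor.hom_ext fun x y => by simp)
    (fun c u v => by
      have e : BTensor.map u (c • v) = c • BTensor.map u v :=
        BTensor.hom_ext fun x y => by simp
      rw [e, LinearMap.smul_comp, smul_comm])

/-- The cap product of a cochain `u : T_r → M` and a chain in `T_n ⊗_{Aᵉ} N`, the composite of
`Δ ⊗ id` and `(x ⊗ y) ⊗ n ↦ (-1)^{|u||x|} x ⊗ (u(y) ⊗ n)`. -/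
def chainCap (r n q : ℤ) (h : q + r = n) :
    (T.X r →ₗ[Env k A] M) →ₗ[k] ETensor k A (T.X n) N →ₗ[k]
      ETensor k A (T.X q) (BTensor k A M N) :=
  LinearMap.mk₂ k
    (fun u z => ((r * q).negOnePow : ℤ) • ETensor.assocHom
      (ETensor.map (BTensor.map LinearMap.id u) LinearMap.id
        (ETensor.map (component Δ q r n h) LinearMap.id z)))
    (fun u u' z => by
      rw [← smul_add, ← map_add, ← LinearMap.add_apply]
      congr 3
      refine ETensor.hom_ext fun t y => ?_
      induction t using BTensor.induction with
      | h0 => simp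
      | ha z z' h h' => simp only [map_add, LinearMap.add_apply, h, h']
      | h x z => simp)
    (fun c u z => by
      have e : ETensor.map (BTensor.map (LinearMap.id (R := Env k A) (M := T.X q)) (c • u))
          (LinearMap.id (R := Env k A) (M := N)) =
          c • ETensor.map (BTensor.map LinearMap.id u) LinearMap.id := by
        refine ETensor.hom_ext fun t y => ?_
        induction t using BTensor.induction with
        | h0 => simp
        | ha z z' h h' => simp only [map_add, LinearMap.add_apply, h, h']
        | h x z => simp
      rw [e, LinearMap.smul_apply, map_smul, smul_comm])
    (fun u z z' => by simp only [map_add, smul_add])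
    (fun c u z => by simp only [map_smul, smul_comm c])

theorem mem_cocycles {n : ℤ} {u : T.X n →ₗ[Env k A] M} :
    u ∈ cocycles T M n ↔ u ∘ₗ (T.d (n + 1) n).hom = 0 := Iff.rfl

theorem component_d_comp {C C' : ChainComplex (ModuleCat.{v} (Env k A)) ℤ}
    (Δ : T ⟶ completeTensor C C') {i j n m i' j' : ℤ} (h : m + 1 = n) (hij : i + j = m)
    (hi : i + 1 = i') (hj : j + 1 = j') (u : C.X i →ₗ[Env k A] M) (v : C'.X j →ₗ[Env k A] N) :
    BTensor.map u v ∘ₗ component Δ i j m hij ∘ₗ (T.d n m).hom =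
      BTensor.map (u ∘ₗ (C.d i' i).hom) v ∘ₗ component Δ i' j n (by omega) +
        (i.negOnePow : ℤ) • BTensor.map u (v ∘ₗ (C'.d j' j).hom) ∘ₗ
          component Δ i j' n (by omega) := by
  ext x
  simp only [LinearMap.comp_apply, LinearMap.add_apply, LinearMap.smul_apply]
  rw [component_d Δ i j n m h hij i' j' hi hj, map_add, map_zsmul, BTensor.map_map,
    BTensor.map_map, LinearMap.comp_id, LinearMap.comp_id]

theorem BTensor.map_zero_left' {X X' Y Y' : Type*}
    [AddCommGroup X] [Module k X] [Module (Env k A) X] [IsScalarTower k (Env k A) X]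
    [AddCommGroup X'] [Module k X'] [Module (Env k A) X'] [IsScalarTower k (Env k A) X']
    [AddCommGroup Y] [Module k Y] [Module (Env k A) Y] [IsScalarTower k (Env k A) Y]
    [AddCommGroup Y'] [Module k Y'] [Module (Env k A) Y'] [IsScalarTower k (Env k A) Y']
    (g : Y →ₗ[Env k A] Y') : BTensor.map (0 : X →ₗ[Env k A] X') g = 0 :=
  LinearMap.ext fun z => BTensor.map_zero_left g z

theorem BTensor.map_zero_right' {X X' Y Y' : Type*}
    [AddCommGroup X] [Module k X] [Module (Env k A) X] [IsScalarTower k (Env k A) X]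
    [AddCommGroup X'] [Module k X'] [Module (Env k A) X'] [IsScalarTower k (Env k A) X']
    [AddCommGroup Y] [Module k Y] [Module (Env k A) Y] [IsScalarTower k (Env k A) Y]
    [AddCommGroup Y'] [Module k Y'] [Module (Env k A) Y'] [IsScalarTower k (Env k A) Y']
    (f : X →ₗ[Env k A] X') : BTensor.map f (0 : Y →ₗ[Env k A] Y') = 0 :=
  LinearMap.ext fun z => BTensor.map_zero_right f z

theorem negOnePow_smul_smul {G : Type*} [AddCommGroup G] (i : ℤ) (x : G) :
    (i.negOnePow : ℤ) • (i.negOnePow : ℤ) • x = x := by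
  rw [smul_smul, ← Units.val_mul, Int.units_mul_self, Units.val_one, one_smul]

/-- The cup product `⌣ : Ĥ^r(A, M) ⊗ Ĥ^s(A, N) → Ĥ^{r+s}(A, M ⊗_A N)`. -/
def cup (r s m : ℤ) (h : r + s = m) :
    TateCohomology T M r →ₗ[k] TateCohomology T N s →ₗ[k]
      TateCohomology T (BTensor k A M N) m :=
  SubQuot.map₂ (cochainCup Δ r s m h)
    (fun u hu v hv => by
      rw [mem_cocycles] at hu hv ⊢
      change ((s * r).negOnePow : ℤ) •
        (BTensor.map u v ∘ₗ component Δ r s m h ∘ₗ (T.d (m + 1) m).hom) = 0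
      rw [component_d_comp Δ rfl h rfl rfl, hu, hv, BTensor.map_zero_left',
        BTensor.map_zero_right']
      simp)
    (fun u hu v hv => by
      obtain ⟨g, rfl⟩ := hu
      rw [mem_cocycles] at hv
      refine ⟨((s * r).negOnePow : ℤ) •
        (BTensor.map g v ∘ₗ component Δ (r - 1) s (m - 1) (by omega)), ?_⟩
      change ((s * r).negOnePow : ℤ) •
        (BTensor.map g v ∘ₗ component Δ (r - 1) s (m - 1) _ ∘ₗ (T.d m (m - 1)).hom) =
        ((s * r).negOnePow : ℤ) •
          (BTensor.map (g ∘ₗ (T.d r (r - 1)).hom) v ∘ₗ component Δ r s m h)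
      rw [component_d_comp Δ (sub_add_cancel m 1) _ (sub_add_cancel r 1) rfl, hv,
        BTensor.map_zero_right']
      simp)
    (fun u hu v hv => by
      obtain ⟨g, rfl⟩ := hv
      rw [mem_cocycles] at hu
      refine ⟨((s * r).negOnePow : ℤ) • (r.negOnePow : ℤ) •
        (BTensor.map u g ∘ₗ component Δ r (s - 1) (m - 1) (by omega)), ?_⟩
      change ((s * r).negOnePow : ℤ) • (r.negOnePow : ℤ) •
        (BTensor.map u g ∘ₗ component Δ r (s - 1) (m - 1) _ ∘ₗ (T.d m (m - 1)).hom) =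
        ((s * r).negOnePow : ℤ) •
          (BTensor.map u (g ∘ₗ (T.d s (s - 1)).hom) ∘ₗ component Δ r s m h)
      rw [component_d_comp Δ (sub_add_cancel m 1) _ rfl (sub_add_cancel s 1), hu,
        BTensor.map_zero_left', LinearMap.zero_comp, zero_add, negOnePow_smul_smul])

/-- The map `Hom_{Aᵉ}(X, Y ⊗_A M) ⊗ (X ⊗_{Aᵉ} N) → Y ⊗_{Aᵉ} (M ⊗_A N)`. -/
def capAux {X Y : Type*}
    [AddCommGroup X] [Module k X] [Module (Env k A) X] [IsScalarTower k (Env k A) X]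
    [AddCommGroup Y] [Module k Y] [Module (Env k A) Y] [IsScalarTower k (Env k A) Y]
    (D : X →ₗ[Env k A] BTensor k A Y M) :
    ETensor k A X N →ₗ[k] ETensor k A Y (BTensor k A M N) :=
  ETensor.assocHom ∘ₗ ETensor.map D LinearMap.id

section capAux
variable {X X' Y Y' : Type*}
    [AddCommGroup X] [Module k X] [Module (Env k A) X] [IsScalarTower k (Env k A) X]
    [AddCommGroup X'] [Module k X'] [Module (Env k A) X'] [IsScalarTower k (Env k A) X']
    [AddCommGroup Y] [Module k Y] [Module (Env k A) Y] [IsScalarTower k (Env k A) Y]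
    [AddCommGroup Y'] [Module k Y'] [Module (Env k A) Y'] [IsScalarTower k (Env k A) Y']

theorem capAux_add (D D' : X →ₗ[Env k A] BTensor k A Y M) (z : ETensor k A X N) :
    capAux (D + D') z = capAux D z + capAux D' z := by
  simp only [capAux]
  rw [← LinearMap.add_apply]
  congr 1
  exact ETensor.hom_ext fun x y => by simp

theorem capAux_zsmul (c : ℤ) (D : X →ₗ[Env k A] BTensor k A Y M) (z : ETensor k A X N) :
    capAux (c • D) z = c • capAux D z := by
  simp only [capAux]
  rw [← LinearMap.smul_apply]
  congr 1
  exact ETensor.hom_ext fun x y => by simp [map_zsmul]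

theorem capAux_zero (z : ETensor k A X N) :
    capAux (0 : X →ₗ[Env k A] BTensor k A Y M) z = 0 := by
  simpa using capAux_zsmul (0 : ℤ) (0 : X →ₗ[Env k A] BTensor k A Y M) z

theorem capAux_comp (D : X →ₗ[Env k A] BTensor k A Y M) (f : X' →ₗ[Env k A] X)
    (z : ETensor k A X' N) :
    capAux (D ∘ₗ f) z = capAux D (ETensor.map f LinearMap.id z) := by
  simp only [capAux]
  rw [← LinearMap.comp_apply]
  congr 1
  exact ETensor.hom_ext fun x y => by simp

theorem map_capAux (D : X →ₗ[Env k A] BTensor k A Y M) (f : Y →ₗ[Env k A] Y')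
    (z : ETensor k A X N) :
    ETensor.map f LinearMap.id (capAux D z) =
      capAux (BTensor.map f LinearMap.id ∘ₗ D) z := by
  simp only [capAux]
  rw [← LinearMap.comp_apply]
  congr 1
  refine ETensor.hom_ext fun x y => ?_
  simp only [LinearMap.comp_apply, ETensor.map_emk]
  generalize D x = t
  induction t using BTensor.induction with
  | h0 => simp
  | ha z z' h h' => simp only [map_add, LinearMap.add_apply, h, h']
  | h x z => simp

end capAux

theorem chainCap_apply (r n q : ℤ) (h : q + r = n) (u : T.X r →ₗ[Env k A] M)
    (z : ETensor k A (T.X n) N) :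
    chainCap Δ r n q h u z =
      ((r * q).negOnePow : ℤ) • capAux (BTensor.map LinearMap.id u ∘ₗ component Δ q r n h) z := by
  rw [capAux_comp]
  rfl

/-- The cap product `⌢ : Ĥ^r(A, M) ⊗ Ĥ_n(A, N) → Ĥ_{n-r}(A, M ⊗_A N)`. -/
def cap (r n q : ℤ) (h : q + r = n) :
    TateCohomology T M r →ₗ[k] TateHomology T N n →ₗ[k]
      TateHomology T (BTensor k A M N) q :=
  SubQuot.map₂ (chainCap Δ r n q h)
    (fun u hu z hz => by
      rw [mem_cocycles] at hu
      rw [cycles, LinearMap.mem_ker] at hz ⊢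
      have e := component_d_comp Δ (sub_add_cancel n 1) (i := q - 1) (j := r) (by omega)
        (sub_add_cancel q 1) rfl LinearMap.id u
      rw [hu, BTensor.map_zero_right', LinearMap.zero_comp, smul_zero, add_zero,
        LinearMap.id_comp] at e
      rw [chainCap_apply, map_zsmul, map_capAux, ← LinearMap.comp_assoc]
      have e' : BTensor.map (T.d q (q - 1)).hom LinearMap.id ∘ₗ BTensor.map LinearMap.id u =
          BTensor.map (T.d q (q - 1)).hom u := BTensor.hom_ext fun x y => by simp
      rw [e', ← e, ← LinearMap.comp_assoc, capAux_comp, hz, map_zero, smul_zero])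
    (fun u hu z hz => by
      obtain ⟨g, rfl⟩ := hu
      rw [cycles, LinearMap.mem_ker] at hz
      have e := component_d_comp Δ (sub_add_cancel n 1) (i := q) (j := r - 1) (by omega)
        rfl (sub_add_cancel r 1) LinearMap.id g
      have e' : BTensor.map (T.d (q + 1) q).hom LinearMap.id ∘ₗ BTensor.map LinearMap.id g =
          BTensor.map (T.d (q + 1) q).hom g := BTensor.hom_ext fun x y => by simp
      have e₂ := congrArg (fun D => capAux D z) e
      rw [← LinearMap.comp_assoc, capAux_comp, hz, map_zero, capAux_add, capAux_zsmul,
        LinearMap.id_comp, ← e', LinearMap.comp_assoc, ← map_capAux, eq_comm,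
        add_eq_zero_iff_neg_eq] at e₂
      have e₃ := congrArg (fun t => (q.negOnePow : ℤ) • t) e₂
      rw [negOnePow_smul_smul] at e₃
      rw [chainCap_apply]
      refine Submodule.smul_of_tower_mem _ _ ?_
      change capAux (BTensor.map LinearMap.id (g ∘ₗ (T.d r (r - 1)).hom) ∘ₗ _) z ∈ _
      rw [← e₃]
      exact Submodule.smul_of_tower_mem _ _ (Submodule.neg_mem _ ⟨_, rfl⟩))
    (fun u hu z hz => by
      rw [mem_cocycles] at hu
      obtain ⟨t, rfl⟩ := hz
      have e := component_d_comp Δ (rfl : n + 1 = n + 1) h rfl rfl LinearMap.id u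
      rw [hu, BTensor.map_zero_right', LinearMap.zero_comp, smul_zero, add_zero,
        LinearMap.id_comp] at e
      have e' : BTensor.map (T.d (q + 1) q).hom LinearMap.id ∘ₗ BTensor.map LinearMap.id u =
          BTensor.map (T.d (q + 1) q).hom u := BTensor.hom_ext fun x y => by simp
      rw [chainCap_apply, ← capAux_comp, LinearMap.comp_assoc, e, ← e', LinearMap.comp_assoc,
        ← map_capAux]
      exact Submodule.smul_of_tower_mem _ _ ⟨_, rfl⟩)

end Tate

end TateHochschild

namespace TateHochschild

/-! ### Lifting and factoring linear maps -/

/-! For a cocycle `u` of degree `r`, the maps `φ_u = (id ⊗ u)Δ : T_{i+r} → T_i ⊗_A L` form a chain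
map, and capping with `u` is, up to sign, the map induced by `φ_u` after tensoring with `N` over
`Aᵉ`. Hence `u ⌢ (v ⌢ _)` comes from `(φ_u ⊗ id) φ_v` and `(u ⌣ v) ⌢ _` from the chain map of `(u ⊗
v)Δ`; both go from `T` to `T ⊗_A (L ⊗_A M)`, and the signs agree. No coassociativity of `Δ` is
assumed, so the two maps need not coincide. A homotopy suffices: applied to a cycle, homotopic maps
differ by a boundary.

Such homotopies are controlled by the augmentation. By `exists_nullhomotopy`, a chain map `T → T ⊗_A
X` whose augmentation `T_m → X` is a coboundary is null-homotopic. With `X = A` this shows that `(ε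
⊗ id)Δ` is homotopic to the identity, so the augmentation `u (ε ⊗ id)Δ` of `φ_u` is cohomologous to
`u`. Both maps above therefore augment to `(u ⊗ v)Δ` up to coboundaries, and
`exists_capHom_homotopy` follows.

The null-homotopy must be built in both directions from degree `0`. Upwards, projectivity of `T_n`
and exactness of `T ⊗_A X` suffice. Downwards, bimodule maps into `T_j ⊗_A X` have to be extended
along differentials, and here the Frobenius form enters. Its Casimir element averages `k`-linear
maps to right linear ones, and right linear maps to bimodule maps. Each `T_j` carries operators
whose averages are the identity (the form of relative projectivity and injectivity used here).
Consequently `T` splits as a complex of right modules (`exists_splitting`), and a right linear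
extension can be averaged to a bimodule map. -/

theorem exists_comp_eq_of_forall_mem_range {R P Y Y' : Type*} [Ring R] [AddCommGroup P]
    [Module R P] [Module.Projective R P] [AddCommGroup Y] [Module R Y] [AddCommGroup Y']
    [Module R Y'] (p : Y' →ₗ[R] Y) (f : P →ₗ[R] Y) (h : ∀ x, ∃ y, p y = f x) :
    ∃ g : P →ₗ[R] Y', ∀ x, p (g x) = f x := by
  obtain ⟨g, hg⟩ := Module.projective_lifting_property p.rangeRestrict
    (f.codRestrict (LinearMap.range p) h) p.surjective_rangeRestrict
  exact ⟨g, fun x => congrArg Subtype.val (LinearMap.congr_fun hg x)⟩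

/-- Over a field, `d` has a section over its range, and this section extends to all of `Y`. -/
theorem exists_generalized_inverse {k X Y : Type*} [Field k] [AddCommGroup X] [Module k X]
    [AddCommGroup Y] [Module k Y] (d : X →ₗ[k] Y) :
    ∃ g : Y →ₗ[k] X, ∀ x, d (g (d x)) = d x := by
  obtain ⟨s, hs⟩ := d.rangeRestrict.exists_rightInverse_of_surjective d.range_rangeRestrict
  obtain ⟨g, hg⟩ := LinearMap.exists_extend s
  refine ⟨g, fun x => ?_⟩
  have h₁ : g (d x) = s (d.rangeRestrict x) := LinearMap.congr_fun hg (d.rangeRestrict x)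
  rw [h₁]
  exact congrArg Subtype.val (LinearMap.congr_fun hs (d.rangeRestrict x))

theorem exists_comp_eq_of_ker_le {k X Y W : Type*} [Field k] [AddCommGroup X] [Module k X]
    [AddCommGroup Y] [Module k Y] [AddCommGroup W] [Module k W] (d : X →ₗ[k] Y)
    (f : X →ₗ[k] W) (h : ∀ x, d x = 0 → f x = 0) :
    ∃ g : Y →ₗ[k] W, ∀ x, g (d x) = f x := by
  obtain ⟨s, hs⟩ := exists_generalized_inverse d
  refine ⟨f ∘ₗ s, fun x => ?_⟩
  rw [LinearMap.comp_apply, ← sub_eq_zero, ← map_sub]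
  exact h _ (by rw [map_sub, hs, sub_self])

/-! ### Frobenius systems -/

/-- A Frobenius system of `A`: a functional together with dual bases for the bilinear form
`(x, y) ↦ form (x * y)`. -/
structure FrobeniusSystem (k : Type u) (A : Type w) [Field k] [Ring A] [Algebra k A] where
  /-- the number of elements of the dual bases -/
  rank : ℕ
  /-- the Frobenius functional -/
  form : A →ₗ[k] k
  /-- the first basis -/
  fst : Fin rank → A
  /-- the dual basis -/
  snd : Fin rank → A
  sum_left : ∀ x, ∑ l, form (fst l * x) • snd l = x
  sum_right : ∀ x, ∑ l, form (x * snd l) • fst l = x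

/-- The functional is `x ↦ B x 1`, so that associativity turns `form (x * y)` into `B x y`. The form
need not be symmetric: the dual basis stands in the left argument of `B` and the chosen basis in the
right one, which gives the two expansions. -/
theorem IsFrobeniusAlgebra.nonempty_frobeniusSystem {k : Type u} {A : Type w} [Field k] [Ring A]
    [Algebra k A] (h : IsFrobeniusAlgebra k A) : Nonempty (FrobeniusSystem k A) := by
  obtain ⟨hfin, B, hB, hassoc⟩ := h
  have hB1 : ∀ x y, B (x * y) 1 = B x y := fun x y => by rw [hassoc, mul_one]
  let b := Module.finBasis k A
  refine ⟨⟨_, LinearMap.flip B 1, B.dualBasis hB b, b, fun x => ?_, fun x => ?_⟩⟩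
  · apply b.repr.injective
    rw [map_sum]
    simp only [map_smul, b.repr_self, LinearMap.flip_apply, hB1]
    ext i
    rw [Finsupp.finsetSum_apply]
    simp only [Finsupp.smul_apply, Finsupp.single_apply, smul_eq_mul, mul_ite, mul_one, mul_zero,
      Finset.sum_ite_eq', Finset.mem_univ, if_true]
    conv_lhs => rw [← b.sum_repr x, map_sum]
    simp [LinearMap.BilinForm.apply_dualBasis_left]
  · simp only [LinearMap.flip_apply, hB1]
    conv_rhs => rw [← (B.dualBasis hB b).sum_repr x]
    simp only [LinearMap.BilinForm.dualBasis_repr_apply]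

namespace FrobeniusSystem

variable {k : Type u} {A : Type w} [Field k] [Ring A] [Algebra k A] (F : FrobeniusSystem k A)

/-- The Casimir element `∑ snd l ⊗ fst l` is `A`-central. -/
theorem casimir {V : Type*} [AddCommGroup V] [Module k V] (f : A →ₗ[k] A →ₗ[k] V) (c : A) :
    ∑ l, f (c * F.snd l) (F.fst l) = ∑ l, f (F.snd l) (F.fst l * c) := by
  -- Multiplication by `c` on either side has the same matrix `form (fst m * c * snd l)` in the two
  -- bases; both sums equal the same double sum.
  have h₁ : ∀ l, f (c * F.snd l) (F.fst l) =
      ∑ m, F.form (F.fst m * c * F.snd l) • f (F.snd m) (F.fst l) := fun l => by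
    conv_lhs => rw [← F.sum_left (c * F.snd l)]
    simp [mul_assoc]
  have h₂ : ∀ m, f (F.snd m) (F.fst m * c) =
      ∑ l, F.form (F.fst m * c * F.snd l) • f (F.snd m) (F.fst l) := fun m => by
    conv_lhs => rw [← F.sum_right (F.fst m * c)]
    simp
  simp only [h₁, h₂]
  exact Finset.sum_comm

end FrobeniusSystem

/-! ### Right linear maps and averaging -/

section Averaging

variable {k : Type u} {A : Type w} [Field k] [Ring A] [Algebra k A]
variable {X : Type*} [AddCommGroup X] [Module k X] [Module (Env k A) X]
  [IsScalarTower k (Env k A) X]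
variable {Y : Type*} [AddCommGroup Y] [Module k Y] [Module (Env k A) Y]
  [IsScalarTower k (Env k A) Y]
variable {Z : Type*} [AddCommGroup Z] [Module k Z] [Module (Env k A) Z]
  [IsScalarTower k (Env k A) Z]

variable (A) in
/-- A `k`-linear map of bimodules that commutes with the right action of `A`. -/
def IsRightLinear (f : X →ₗ[k] Y) : Prop :=
  ∀ (a : A) (x : X), f (ract k a x) = ract k a (f x)

theorem isRightLinear_restrictScalars (f : X →ₗ[Env k A] Y) :
    IsRightLinear A (f.restrictScalars k) := fun a x => map_ract k f a x

theorem IsRightLinear.comp {f : Y →ₗ[k] Z} {g : X →ₗ[k] Y} (hf : IsRightLinear A f)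
    (hg : IsRightLinear A g) : IsRightLinear A (f ∘ₗ g) := fun a x => by
  rw [LinearMap.comp_apply, hg, hf, LinearMap.comp_apply]

theorem IsRightLinear.sub {f g : X →ₗ[k] Y} (hf : IsRightLinear A f) (hg : IsRightLinear A g) :
    IsRightLinear A (f - g) := fun a x => by
  simp only [LinearMap.sub_apply, hf a x, hg a x, map_sub]

theorem lact_one (x : X) : lact k (1 : A) x = x := by
  rw [lact_apply, ← Algebra.TensorProduct.one_def, one_smul]

theorem ract_one (x : X) : ract k (1 : A) x = x := by
  rw [ract_apply, op_one, ← Algebra.TensorProduct.one_def, one_smul]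

theorem lact_ract_comm (a b : A) (x : X) :
    lact k a (ract k b x) = ract k b (lact k a x) := by
  rw [lact_ract, ract_lact]

variable (k A X) in
/-- The left action as a linear map in the scalar. -/
def lactₗ : A →ₗ[k] X →ₗ[k] X where
  toFun := lact k
  map_add' a b := by ext x; simp [lact_apply, TensorProduct.add_tmul, add_smul]
  map_smul' c a := by ext x; simp [lact_apply, ← TensorProduct.smul_tmul']

variable (k A X) in
/-- The right action as a linear map in the scalar. -/
def ractₗ : A →ₗ[k] X →ₗ[k] X where
  toFun := ract k
  map_add' a b := by ext x; simp [ract_apply, TensorProduct.tmul_add, add_smul]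
  map_smul' c a := by ext x; simp [ract_apply]

@[simp] theorem lactₗ_apply (a : A) : lactₗ k A X a = lact k a := rfl
@[simp] theorem ractₗ_apply (a : A) : ractₗ k A X a = ract k a := rfl

namespace FrobeniusSystem

variable (F : FrobeniusSystem k A)

/-- The left average `x ↦ ∑ snd l • f (fst l • x)`. -/
def averageLeft (f : X →ₗ[k] Y) : X →ₗ[k] Y :=
  ∑ l, lact k (F.snd l) ∘ₗ f ∘ₗ lact k (F.fst l)

/-- The right average `x ↦ ∑ f (x • snd l) • fst l`. -/
def averageRight (f : X →ₗ[k] Y) : X →ₗ[k] Y :=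
  ∑ l, ract k (F.fst l) ∘ₗ f ∘ₗ ract k (F.snd l)

theorem averageLeft_apply (f : X →ₗ[k] Y) (x : X) :
    F.averageLeft f x = ∑ l, lact k (F.snd l) (f (lact k (F.fst l) x)) := by
  simp [averageLeft]

theorem averageRight_apply (f : X →ₗ[k] Y) (x : X) :
    F.averageRight f x = ∑ l, ract k (F.fst l) (f (ract k (F.snd l) x)) := by
  simp [averageRight]

/-- The Casimir identity for the bilinear map `(a, b) ↦ a • f (b • x)`. -/
theorem averageLeft_lact (f : X →ₗ[k] Y) (c : A) (x : X) :
    F.averageLeft f (lact k c x) = lact k c (F.averageLeft f x) := by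
  have := F.casimir (((lactₗ k A Y).compl₂ (f ∘ₗ (lactₗ k A X).flip x))) c
  simp only [averageLeft_apply, map_sum]
  simpa [lact_mul] using this.symm

/-- The Casimir identity for `(a, b) ↦ f (x • a) • b`; nothing but `k`-linearity of `f` is needed.
-/
theorem isRightLinear_averageRight (f : X →ₗ[k] Y) :
    IsRightLinear A (F.averageRight f) := fun c x => by
  have := F.casimir (((ractₗ k A Y).compl₂ (f ∘ₗ (ractₗ k A X).flip x)).flip) c
  simp only [averageRight_apply, map_sum]
  simpa [ract_mul] using this

theorem isRightLinear_averageLeft {f : X →ₗ[k] Y} (hf : IsRightLinear A f) :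
    IsRightLinear A (F.averageLeft f) := fun c x => by
  simp only [averageLeft_apply, map_sum, lact_ract_comm, hf _ _]

/-- The left average of a right linear map is a bimodule map. -/
def averageHom (f : X →ₗ[k] Y) (hf : IsRightLinear A f) : X →ₗ[Env k A] Y :=
  bimoduleHom k (F.averageLeft f) (fun a b x => by
    rw [averageLeft_lact, F.isRightLinear_averageLeft hf])

theorem averageHom_apply (f : X →ₗ[k] Y) (hf : IsRightLinear A f) (x : X) :
    F.averageHom f hf x = F.averageLeft f x := rfl

/-- Lifting of right linear maps out of a bimodule with a right averaging operator. -/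
theorem exists_rightLinear_lift {θ : X →ₗ[k] X} (hθ : ∀ x, F.averageRight θ x = x)
    {p : Y →ₗ[k] Z} (hp : IsRightLinear A p) {f : X →ₗ[k] Z} (hf : IsRightLinear A f)
    (h : ∀ x, ∃ y, p y = f x) :
    ∃ g : X →ₗ[k] Y, IsRightLinear A g ∧ ∀ x, p (g x) = f x := by
  obtain ⟨g, hg⟩ := exists_comp_eq_of_forall_mem_range p f h
  -- Any `k`-linear lift `g` will do. Since `p` and `f` are right linear, they pass through the sum,
  -- and what remains is the average of `θ`.
  refine ⟨F.averageRight (g ∘ₗ θ), F.isRightLinear_averageRight _, fun x => ?_⟩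
  conv_rhs => rw [← hθ x]
  simp only [averageRight_apply, map_sum, LinearMap.comp_apply, hp _ _, hf _ _, hg]

/-- Extension of right linear maps into a bimodule with a right averaging operator. -/
theorem exists_rightLinear_extension {θ : Z →ₗ[k] Z} (hθ : ∀ x, F.averageRight θ x = x)
    {d : X →ₗ[k] Y} (hd : IsRightLinear A d) {f : X →ₗ[k] Z} (hf : IsRightLinear A f)
    (h : ∀ x, d x = 0 → f x = 0) :
    ∃ g : Y →ₗ[k] Z, IsRightLinear A g ∧ ∀ x, g (d x) = f x := by
  obtain ⟨g, hg⟩ := exists_comp_eq_of_ker_le d f h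
  -- Dual to the lifting argument: `θ` now acts on the target, after an arbitrary `k`-linear
  -- extension `g`.
  refine ⟨F.averageRight (θ ∘ₗ g), F.isRightLinear_averageRight _, fun x => ?_⟩
  conv_rhs => rw [← hθ (f x)]
  simp only [averageRight_apply, LinearMap.comp_apply, ← hd _ _, ← hf _ _, hg]

/-- A bimodule map that extends right linearly extends to a bimodule map if its target has a
left averaging operator. -/
theorem exists_extension {θ : Z →ₗ[k] Z} (hθr : IsRightLinear A θ)
    (hθ : ∀ x, F.averageLeft θ x = x) (d : X →ₗ[Env k A] Y) (f : X →ₗ[Env k A] Z)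
    {g : Y →ₗ[k] Z} (hgr : IsRightLinear A g) (hg : ∀ x, g (d x) = f x) :
    ∃ e : Y →ₗ[Env k A] Z, e ∘ₗ d = f := by
  refine ⟨F.averageHom (θ ∘ₗ g) (hθr.comp hgr), LinearMap.ext fun x => ?_⟩
  rw [LinearMap.comp_apply, averageHom_apply, ← hθ (f x)]
  simp only [averageLeft_apply, LinearMap.comp_apply, ← map_lact, hg]

end FrobeniusSystem

end Averaging

/-! ### Averaging operators on projective bimodules -/

section Projective

variable {k : Type u} {A : Type w} [Field k] [Ring A] [Algebra k A] (F : FrobeniusSystem k A)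

theorem env_lact_tmul (a b : A) (c : Aᵐᵒᵖ) :
    lact k a (b ⊗ₜ[k] c : Env k A) = (a * b) ⊗ₜ[k] c := by
  rw [lact_apply, smul_eq_mul, Algebra.TensorProduct.tmul_mul_tmul, one_mul]

theorem env_ract_tmul (a b : A) (c : Aᵐᵒᵖ) :
    ract k a (b ⊗ₜ[k] c : Env k A) = b ⊗ₜ[k] (op a * c) := by
  rw [ract_apply, smul_eq_mul, Algebra.TensorProduct.tmul_mul_tmul, one_mul]

namespace FrobeniusSystem

/-- The operator `a ⊗ b ↦ form a ⊗ b` on the enveloping algebra. -/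
def envLeft : Env k A →ₗ[k] Env k A :=
  TensorProduct.map (Algebra.linearMap k A ∘ₗ F.form) LinearMap.id

/-- The operator `a ⊗ b ↦ a ⊗ form b` on the enveloping algebra. -/
def envRight : Env k A →ₗ[k] Env k A :=
  TensorProduct.map LinearMap.id
    (Algebra.linearMap k Aᵐᵒᵖ ∘ₗ F.form ∘ₗ (opLinearEquiv k).symm.toLinearMap)

theorem isRightLinear_envLeft : IsRightLinear A F.envLeft := fun c x => by
  induction x using TensorProduct.induction_on with
  | zero => simp
  | add x y hx hy => simp only [map_add, hx, hy]
  | tmul a b => simp [env_ract_tmul, envLeft]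

/-- On `a ⊗ b` the average is `∑ form (fst l * a) • snd l ⊗ b`, and the dual basis expansion
recovers `a`. -/
theorem averageLeft_envLeft (x : Env k A) : F.averageLeft F.envLeft x = x := by
  induction x using TensorProduct.induction_on with
  | zero => simp
  | add x y hx hy => rw [map_add, hx, hy]
  | tmul a b =>
    rw [averageLeft_apply]
    conv_rhs => rw [← F.sum_left a]
    simp [env_lact_tmul, envLeft, TensorProduct.sum_tmul, Algebra.algebraMap_eq_smul_one]

theorem averageRight_envRight (x : Env k A) : F.averageRight F.envRight x = x := by
  induction x using TensorProduct.induction_on with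
  | zero => simp
  | add x y hx hy => rw [map_add, hx, hy]
  | tmul a b =>
    rw [averageRight_apply]
    conv_rhs => rw [← op_unop b, ← F.sum_right b.unop]
    simp [env_ract_tmul, envRight, TensorProduct.tmul_sum, Algebra.algebraMap_eq_smul_one]

end FrobeniusSystem

/-- The dual basis lemma for finitely generated projective modules. -/
theorem exists_dualBasis_of_projective {R P : Type*} [Ring R] [AddCommGroup P] [Module R P]
    [Module.Finite R P] [Module.Projective R P] :
    ∃ (n : ℕ) (p : Fin n → P) (s : Fin n → (P →ₗ[R] R)), ∀ x, ∑ i, s i x • p i = x := by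
  obtain ⟨n, f, g, -, -, h⟩ := Module.Finite.exists_comp_eq_id_of_projective R P
  refine ⟨n, fun i => f (Pi.single i 1), fun i => LinearMap.proj i ∘ₗ g, fun x => ?_⟩
  conv_rhs => rw [← LinearMap.id_apply (R := R) x, ← h, LinearMap.comp_apply,
    LinearMap.pi_apply_eq_sum_univ f (g x)]
  refine Finset.sum_congr rfl fun i _ => congrArg (fun y => g x i • f y) ?_
  ext j
  simp [Pi.single_apply, eq_comm]

namespace FrobeniusSystem

variable {P : Type*} [AddCommGroup P] [Module k P] [Module (Env k A) P]
  [IsScalarTower k (Env k A) P]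

/-- The operator induced on a module with a dual basis by an operator on the ring. -/
def inducedOperator {n : ℕ} (p : Fin n → P) (s : Fin n → (P →ₗ[Env k A] Env k A))
    (θ : Env k A →ₗ[k] Env k A) : P →ₗ[k] P :=
  ∑ i, (LinearMap.toSpanSingleton (Env k A) P (p i)).restrictScalars k ∘ₗ θ ∘ₗ
    (s i).restrictScalars k

theorem inducedOperator_apply {n : ℕ} (p : Fin n → P) (s : Fin n → (P →ₗ[Env k A] Env k A))
    (θ : Env k A →ₗ[k] Env k A) (x : P) :
    inducedOperator p s θ x =
      ∑ i, LinearMap.toSpanSingleton (Env k A) P (p i) (θ (s i x)) := by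
  simp [inducedOperator]

/-- With `x = ∑ s_i(x) p_i` for a dual basis, the operator of `Aᵉ` is applied to the coefficients
`s_i(x)`. Averaging commutes with the bimodule maps `s_i` and `e ↦ e • p_i`, so the claim reduces to
`Aᵉ`. Right linearity is recorded because it is needed to tensor the operator with `X` over `A`. -/
theorem exists_averageLeft_of_projective [Module.Finite (Env k A) P]
    [Module.Projective (Env k A) P] :
    ∃ θ : P →ₗ[k] P, IsRightLinear A θ ∧ ∀ x, F.averageLeft θ x = x := by
  obtain ⟨n, p, s, hs⟩ := exists_dualBasis_of_projective (R := Env k A) (P := P)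
  refine ⟨inducedOperator p s F.envLeft, fun a x => ?_, fun x => ?_⟩
  · simp only [inducedOperator_apply, map_sum, map_ract, F.isRightLinear_envLeft a _]
  · simp only [averageLeft_apply, inducedOperator_apply, map_sum]
    rw [Finset.sum_comm]
    conv_rhs => rw [← hs x]
    refine Finset.sum_congr rfl fun i _ => ?_
    conv_rhs => rw [← F.averageLeft_envLeft (s i x), ← LinearMap.toSpanSingleton_apply]
    simp only [averageLeft_apply, map_sum, map_lact]

theorem exists_averageRight_of_projective [Module.Finite (Env k A) P]
    [Module.Projective (Env k A) P] :
    ∃ θ : P →ₗ[k] P, ∀ x, F.averageRight θ x = x := by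
  obtain ⟨n, p, s, hs⟩ := exists_dualBasis_of_projective (R := Env k A) (P := P)
  refine ⟨inducedOperator p s F.envRight, fun x => ?_⟩
  simp only [averageRight_apply, inducedOperator_apply, map_sum]
  rw [Finset.sum_comm]
  conv_rhs => rw [← hs x]
  refine Finset.sum_congr rfl fun i _ => ?_
  conv_rhs => rw [← F.averageRight_envRight (s i x), ← LinearMap.toSpanSingleton_apply]
  simp only [averageRight_apply, map_sum, map_ract]

end FrobeniusSystem

end Projective

/-! ### Right linear splittings of a complete resolution -/

section Splitting

variable {k : Type u} {A : Type w} [Field k] [Ring A] [Algebra k A]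

theorem self_ract (a x : A) : ract k a x = x * a := by
  rw [ract_apply, self_smul, one_mul]

theorem self_lact (a x : A) : lact k a x = a * x := by
  rw [lact_apply, ← op_one, self_smul, mul_one]

namespace CompleteResolution

variable (T : CompleteResolution.{u, w, v} k A)

theorem d_d_apply (i j l : ℤ) (x : T.cx.X i) : (T.cx.d j l).hom ((T.cx.d i j).hom x) = 0 :=
  LinearMap.congr_fun (d_comp_d_hom T.cx i j l) x

theorem exists_d_eq {i j l : ℤ} (hij : j + 1 = i) (hjl : l + 1 = j) {x : T.cx.X j}
    (hx : (T.cx.d j l).hom x = 0) : ∃ y, (T.cx.d i j).hom y = x := by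
  obtain rfl : l = j - 1 := by omega
  subst hij
  exact (T.exact j x).1 hx

/-- The differentials of a complete resolution have right linear generalized inverses. -/
theorem exists_splitting (F : FrobeniusSystem k A) {i j : ℤ} (hij : j + 1 = i) :
    ∃ s : T.cx.X j →ₗ[k] T.cx.X i, IsRightLinear A s ∧
      ∀ x, (T.cx.d i j).hom (s ((T.cx.d i j).hom x)) = (T.cx.d i j).hom x := by
  have hfin := T.finite
  have hproj := T.projective
  have hr : ∀ i j : ℤ, IsRightLinear A ((T.cx.d i j).hom.restrictScalars k) :=
    fun i j => isRightLinear_restrictScalars _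
  have hid : ∀ i : ℤ, IsRightLinear A (LinearMap.id : T.cx.X i →ₗ[k] T.cx.X i) :=
    fun i a x => rfl
  -- The splitting is built outwards from degree `0`, where the augmentation supplies a starting
  -- point.
  have main : ∀ j i : ℤ, j + 1 = i → ∃ s : T.cx.X j →ₗ[k] T.cx.X i, IsRightLinear A s ∧
      ∀ x, (T.cx.d i j).hom (s ((T.cx.d i j).hom x)) = (T.cx.d i j).hom x := by
    intro j
    induction j using Int.induction_on with
    | zero =>
      intro i hi
      obtain rfl : i = 1 := by omega
      obtain ⟨e, he⟩ := T.ε_surjective 1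
      obtain ⟨θ, hθ⟩ := F.exists_averageRight_of_projective (P := T.cx.X 0)
      -- With `ε e = 1`, the map `σ x = e • ε(x)` is `ε` followed by the right linear section `a ↦ e
      -- • a`. Thus `id - σ` takes values in `ker ε = im d₁` and lifts along `d₁`.
      let σ : T.cx.X 0 →ₗ[k] T.cx.X 0 :=
        (ractₗ k A (T.cx.X 0)).flip e ∘ₗ T.ε.restrictScalars k
      have hσ : ∀ x, σ x = ract k (T.ε x) e := fun x => rfl
      have hεσ : ∀ x, T.ε (σ x) = T.ε x := fun x => by
        rw [hσ, map_ract, he, self_ract, one_mul]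
      have hσr : IsRightLinear A σ := fun a x => by
        rw [hσ, hσ, map_ract, self_ract, ract_mul]
      obtain ⟨s, hsr, hs⟩ := F.exists_rightLinear_lift hθ (hr 1 0) ((hid 0).sub hσr)
        (fun x => (T.ε_exact _).1 (by simp [hεσ]))
      refine ⟨s, hsr, fun x => ?_⟩
      have h₁ := hs ((T.cx.d 1 0).hom x)
      have h₂ : T.ε ((T.cx.d 1 0).hom x) = 0 := (T.ε_exact _).2 ⟨x, rfl⟩
      have h₃ : σ ((T.cx.d 1 0).hom x) = 0 := by
        rw [hσ, h₂]; exact LinearMap.congr_fun (map_zero (ractₗ k A (T.cx.X 0))) e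
      rw [LinearMap.sub_apply, h₃, sub_zero] at h₁
      exact h₁
    | succ n ih =>
      intro i hi
      obtain ⟨s, hsr, hs⟩ := ih _ rfl
      obtain ⟨θ, hθ⟩ := F.exists_averageRight_of_projective (P := T.cx.X (n + 1))
      -- `id - s d` takes values in cycles, hence in boundaries; a lift `t` satisfies `d t = id - s
      -- d`, and precomposing with `d` gives `d t d = d`.
      obtain ⟨t, htr, ht⟩ := F.exists_rightLinear_lift hθ (hr i (n + 1))
        ((hid (n + 1)).sub (hsr.comp (hr (n + 1) n)))
        (fun x => T.exists_d_eq hi rfl (by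
          change (T.cx.d (n + 1) n).hom (x - s ((T.cx.d (n + 1) n).hom x)) = 0
          rw [map_sub, hs, sub_self]))
      refine ⟨t, htr, fun x => (ht _).trans ?_⟩
      change (T.cx.d i (n + 1)).hom x - s ((T.cx.d (n + 1) n).hom _) = _
      rw [d_d_apply, map_zero, sub_zero]
    | pred n ih =>
      intro i hi
      obtain rfl : i = -n := by omega
      obtain ⟨s, hsr, hs⟩ := ih _ rfl
      obtain ⟨θ, hθ⟩ := F.exists_averageRight_of_projective (P := T.cx.X (-n))
      -- Below degree `0` the roles are reversed: `id - d s` kills boundaries, hence the kernel of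
      -- the next differential, and so extends to `t` with `t d = id - d s`.
      obtain ⟨t, htr, ht⟩ := F.exists_rightLinear_extension hθ (hr (-n) (-n - 1))
        ((hid (-n)).sub ((hr (-n + 1) (-n)).comp hsr))
        (fun x hx => by
          obtain ⟨y, rfl⟩ := T.exists_d_eq rfl hi hx
          change (T.cx.d (-n + 1) (-n)).hom y - (T.cx.d (-n + 1) (-n)).hom (s _) = 0
          rw [hs, sub_self])
      refine ⟨t, htr, fun x => ?_⟩
      have h := ht x
      change t ((T.cx.d (-n) (-n - 1)).hom x) = x - (T.cx.d (-n + 1) (-n)).hom (s x) at h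
      rw [h, map_sub, d_d_apply, sub_zero]
  exact main j i hij

end CompleteResolution

end Splitting

/-! ### The complex `T ⊗_A X` -/

section Coefficients

variable {k : Type u} {A : Type w} [Field k] [Ring A] [Algebra k A]
variable {X : Type*} [AddCommGroup X] [Module k X] [Module (Env k A) X]
  [IsScalarTower k (Env k A) X]
variable {Y : Type*} [AddCommGroup Y] [Module k Y] [Module (Env k A) Y]
  [IsScalarTower k (Env k A) Y]
variable {Z : Type*} [AddCommGroup Z] [Module k Z] [Module (Env k A) Z]
  [IsScalarTower k (Env k A) Z]

variable (X) in
/-- The map `f ⊗_A X` for a right linear map `f`. -/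
def BTensor.mapRight (f : Y →ₗ[k] Z) (hf : IsRightLinear A f) :
    BTensor k A Y X →ₗ[k] BTensor k A Z X :=
  BTensor.lift ((bmk k A).comp f) (fun a y x => by
    simp only [LinearMap.comp_apply, hf a y, bmk_balanced])

@[simp]
theorem BTensor.mapRight_bmk (f : Y →ₗ[k] Z) (hf : IsRightLinear A f) (y : Y) (x : X) :
    BTensor.mapRight X f hf (bmk k A y x) = bmk k A (f y) x := by
  simp [BTensor.mapRight]

theorem BTensor.isRightLinear_mapRight (f : Y →ₗ[k] Z) (hf : IsRightLinear A f) :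
    IsRightLinear A (BTensor.mapRight X f hf) := fun a z => by
  induction z using BTensor.induction with
  | h0 => simp
  | ha z z' h h' => simp only [map_add, h, h']
  | h y x => simp [ract_bmk]

/-- The left action on `Y ⊗_A X` only involves `Y`, so an averaging operator on `Y` serves for every
coefficient bimodule `X`. This is what allows arbitrary `L` and `M`. -/
theorem FrobeniusSystem.averageLeft_mapRight (F : FrobeniusSystem k A) {θ : Y →ₗ[k] Y}
    (hθr : IsRightLinear A θ) (hθ : ∀ y, F.averageLeft θ y = y) (z : BTensor k A Y X) :
    F.averageLeft (BTensor.mapRight X θ hθr) z = z := by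
  induction z using BTensor.induction with
  | h0 => simp
  | ha z z' h h' => rw [map_add, h, h']
  | h y x =>
    conv_rhs => rw [← hθ y]
    simp [averageLeft_apply, lact_bmk]

variable (k A X) in
/-- The isomorphism `A ⊗_A X → X`, `a ⊗ x ↦ a x`. -/
def BTensor.leftUnit : BTensor k A A X →ₗ[Env k A] X :=
  BTensor.liftE (lactₗ k A X)
    (fun a x y => by simp [self_ract, lact_mul])
    (fun a b x y => by simp [self_lact, lact_mul, lact_ract_comm])

@[simp]
theorem BTensor.leftUnit_bmk (a : A) (x : X) :
    BTensor.leftUnit k A X (bmk k A a x) = lact k a x :=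
  BTensor.liftE_bmk (A := A) (lactₗ k A X) _ _ a x

theorem BTensor.leftUnit_map (f : X →ₗ[Env k A] Y) (z : BTensor k A A X) :
    BTensor.leftUnit k A Y (BTensor.map LinearMap.id f z) = f (BTensor.leftUnit k A X z) := by
  induction z using BTensor.induction with
  | h0 => simp
  | ha z z' h h' => simp only [map_add, h, h']
  | h a x => simp [map_lact]

/-! ### Exactness of `T ⊗_A X` and null-homotopies of maps into it. -/

namespace CompleteResolution

variable (T : CompleteResolution.{u, w, v} k A)

variable (X) in
/-- The augmentation `T_0 ⊗_A X → X`. -/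
def augment : BTensor k A (T.cx.X 0) X →ₗ[Env k A] X :=
  BTensor.leftUnit k A X ∘ₗ BTensor.map T.ε LinearMap.id

theorem augment_surjective : Function.Surjective (T.augment X) := fun x => by
  obtain ⟨e, he⟩ := T.ε_surjective 1
  exact ⟨bmk k A e x, by simp [augment, he, lact_one]⟩

theorem augment_d (z : BTensor k A (T.cx.X 1) X) :
    T.augment X (BTensor.map (T.cx.d 1 0).hom LinearMap.id z) = 0 := by
  have h : T.ε ∘ₗ (T.cx.d 1 0).hom = 0 :=
    LinearMap.ext fun x => (T.ε_exact _).2 ⟨x, rfl⟩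
  rw [augment, LinearMap.comp_apply, BTensor.map_map, h, BTensor.map_zero_left, map_zero]

/-- For every `z`, the difference of `z` and `e ⊗ (augmentation of z)` is a boundary, where `ε e =
1`. On `t ⊗ x` this holds because `t - e • ε(t)` lies in `ker ε`, and `e • ε(t) ⊗ x = e ⊗ ε(t) • x`.
-/
theorem exists_d_eq_of_augment_eq_zero {z : BTensor k A (T.cx.X 0) X}
    (hz : T.augment X z = 0) :
    ∃ y, BTensor.map (T.cx.d 1 0).hom (LinearMap.id (R := Env k A) (M := X)) y = z := by
  obtain ⟨e, he⟩ := T.ε_surjective 1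
  have key : ∀ z : BTensor k A (T.cx.X 0) X, ∃ y,
      BTensor.map (T.cx.d 1 0).hom (LinearMap.id (R := Env k A) (M := X)) y =
        z - bmk k A e (T.augment X z) := fun z => by
    induction z using BTensor.induction with
    | h0 => exact ⟨0, by simp⟩
    | ha z z' h h' =>
      obtain ⟨y, hy⟩ := h
      obtain ⟨y', hy'⟩ := h'
      exact ⟨y + y', by rw [map_add, hy, hy', map_add, map_add]; abel⟩
    | h t x =>
      have h₁ : T.ε (t - ract k (T.ε t) e) = 0 := by
        rw [map_sub, map_ract, he, self_ract, one_mul, sub_self]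
      obtain ⟨y, hy⟩ := (T.ε_exact _).1 h₁
      refine ⟨bmk k A y x, ?_⟩
      rw [BTensor.map_bmk, hy, map_sub, LinearMap.sub_apply, LinearMap.id_apply, bmk_balanced]
      simp [augment]
  obtain ⟨y, hy⟩ := key z
  exact ⟨y, by rw [hy, hz, map_zero, sub_zero]⟩

/-- A right linear splitting survives tensoring with `X`: the element `z - (s ⊗ X)(d ⊗ X) z` is
always a boundary, since `t - s d t` is a cycle of `T`. -/
theorem exists_map_d_eq (F : FrobeniusSystem k A) {i j l : ℤ} (hij : j + 1 = i)
    (hjl : l + 1 = j) {z : BTensor k A (T.cx.X j) X}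
    (hz : BTensor.map (T.cx.d j l).hom (LinearMap.id (R := Env k A) (M := X)) z = 0) :
    ∃ y, BTensor.map (T.cx.d i j).hom (LinearMap.id (R := Env k A) (M := X)) y = z := by
  obtain ⟨s, hsr, hs⟩ := T.exists_splitting F hjl
  have key : ∀ z : BTensor k A (T.cx.X j) X, ∃ y,
      BTensor.map (T.cx.d i j).hom (LinearMap.id (R := Env k A) (M := X)) y =
        z - BTensor.mapRight X s hsr (BTensor.map (T.cx.d j l).hom LinearMap.id z) := fun z => by
    induction z using BTensor.induction with
    | h0 => exact ⟨0, by simp⟩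
    | ha z z' h h' =>
      obtain ⟨y, hy⟩ := h
      obtain ⟨y', hy'⟩ := h'
      exact ⟨y + y', by rw [map_add, hy, hy', map_add, map_add]; abel⟩
    | h t x =>
      obtain ⟨y, hy⟩ := T.exists_d_eq hij hjl (x := t - s ((T.cx.d j l).hom t))
        (by rw [map_sub, hs, sub_self])
      refine ⟨bmk k A y x, ?_⟩
      rw [BTensor.map_bmk, hy, map_sub, LinearMap.sub_apply, LinearMap.id_apply]
      simp
  obtain ⟨y, hy⟩ := key z
  exact ⟨y, by rw [hy, hz, map_zero, sub_zero]⟩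

/-- A bimodule map `T_i → T_j ⊗_A X` that vanishes on boundaries extends along the
differential of `T`. -/
theorem exists_extension (F : FrobeniusSystem k A) {i' i l j : ℤ} (hi : i + 1 = i')
    (hl : l + 1 = i) (f : T.cx.X i →ₗ[Env k A] BTensor k A (T.cx.X j) X)
    (hf : f ∘ₗ (T.cx.d i' i).hom = 0) :
    ∃ e : T.cx.X l →ₗ[Env k A] BTensor k A (T.cx.X j) X, e ∘ₗ (T.cx.d i l).hom = f := by
  have := T.finite j
  have := T.projective j
  obtain ⟨θ, hθr, hθ⟩ := F.exists_averageLeft_of_projective (P := T.cx.X j)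
  obtain ⟨s, hsr, hs⟩ := T.exists_splitting F hl
  -- `f ∘ s` is a right linear extension: `s d x - x` is a cycle, hence a boundary, and `f` kills
  -- it. Averaging on the left turns it into a bimodule map.
  refine F.exists_extension (BTensor.isRightLinear_mapRight θ hθr)
    (F.averageLeft_mapRight hθr hθ) (T.cx.d i l).hom f
    ((isRightLinear_restrictScalars f).comp hsr) (fun x => ?_)
  obtain ⟨y, hy⟩ := T.exists_d_eq hi hl (x := s ((T.cx.d i l).hom x) - x)
    (by rw [map_sub, hs, sub_self])
  have h : f (s ((T.cx.d i l).hom x) - x) = 0 := hy ▸ LinearMap.congr_fun hf y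
  rw [map_sub, sub_eq_zero] at h
  exact h

/-- A chain map `φ : T → T ⊗_A X` of degree `-m` whose augmentation is a coboundary is
null-homotopic. -/
theorem exists_nullhomotopy (F : FrobeniusSystem k A) (m : ℤ)
    (φ : ∀ i n : ℤ, i + m = n → (T.cx.X n →ₗ[Env k A] BTensor k A (T.cx.X i) X))
    (hφ : ∀ (i n i' n' : ℤ) (h : i + m = n) (h' : i' + m = n'), i + 1 = i' →
      φ i n h ∘ₗ (T.cx.d n' n).hom =
        BTensor.map (T.cx.d i' i).hom LinearMap.id ∘ₗ φ i' n' h')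
    (hε : ∃ g : T.cx.X (m - 1) →ₗ[Env k A] X,
      T.augment X ∘ₗ φ 0 m (zero_add m) = g ∘ₗ (T.cx.d m (m - 1)).hom)
    {i n i' l : ℤ} (h : i + m = n) (hi : i + 1 = i') (hl : l + 1 = n) :
    ∃ (a : T.cx.X l →ₗ[Env k A] BTensor k A (T.cx.X i) X)
      (b : T.cx.X n →ₗ[Env k A] BTensor k A (T.cx.X i') X),
      φ i n h = BTensor.map (T.cx.d i' i).hom LinearMap.id ∘ₗ b + a ∘ₗ (T.cx.d n l).hom := by
  have hproj := T.projective
  induction i using Int.induction_on generalizing n i' l with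
  | zero =>
    obtain rfl : n = m := by omega
    obtain rfl : l = n - 1 := by omega
    obtain rfl : i' = 1 := by omega
    obtain ⟨g, hg⟩ := hε
    -- Lifting `g` through the augmentation gives `a`. Then `φ - a d` has augmentation zero, so it
    -- lifts through `d₁`.
    obtain ⟨a, ha⟩ := exists_comp_eq_of_forall_mem_range (T.augment X) g
      (fun x => T.augment_surjective _)
    obtain ⟨b, hb⟩ := exists_comp_eq_of_forall_mem_range
      (BTensor.map (T.cx.d 1 0).hom (LinearMap.id (R := Env k A) (M := X)))
      (φ 0 n h - a ∘ₗ (T.cx.d n (n - 1)).hom)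
      (fun x => T.exists_d_eq_of_augment_eq_zero (by
        rw [LinearMap.sub_apply, map_sub, LinearMap.comp_apply, ha, sub_eq_zero]
        exact LinearMap.congr_fun hg x))
    refine ⟨a, b, LinearMap.ext fun x => ?_⟩
    rw [LinearMap.add_apply, LinearMap.comp_apply, hb, LinearMap.sub_apply, sub_add_cancel]
  | succ j ih =>
    obtain ⟨a, b, hab⟩ := ih (n := l) (i' := j + 1) (l := l - 1) (by omega) rfl (by omega)
    -- The component `b` of the previous degree is kept. From `φ_j = d b + a d` one gets `d (φ_{j+1}
    -- - b d) = φ_j d - d b d = 0`, so the remainder lifts along `d`.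
    obtain ⟨c, hc⟩ := exists_comp_eq_of_forall_mem_range
      (BTensor.map (T.cx.d i' (j + 1)).hom (LinearMap.id (R := Env k A) (M := X)))
      (φ (j + 1) n h - b ∘ₗ (T.cx.d n l).hom)
      (fun x => T.exists_map_d_eq F hi rfl (by
        have h₁ := LinearMap.congr_fun (hφ j l (j + 1) n (by omega) h rfl) x
        have h₂ := LinearMap.congr_fun hab ((T.cx.d n l).hom x)
        simp only [LinearMap.comp_apply, LinearMap.add_apply, d_d_apply, map_zero, add_zero]
          at h₁ h₂
        rw [LinearMap.sub_apply, map_sub, ← h₁, h₂, LinearMap.comp_apply, sub_self]))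
    refine ⟨b, c, LinearMap.ext fun x => ?_⟩
    rw [LinearMap.add_apply, LinearMap.comp_apply, hc, LinearMap.sub_apply, sub_add_cancel]
  | pred j ih =>
    obtain rfl : i' = -j := by omega
    obtain ⟨a, b, hab⟩ := ih (n := n + 1) (i' := -j + 1) (l := n) (by omega) rfl rfl
    -- Now `a` is kept from the degree above. The remainder `φ - d a` vanishes on boundaries,
    -- because its composite with `d` is `d (d b + a d) - d a d = 0`, so it extends along the
    -- outgoing differential.
    obtain ⟨c, hc⟩ := T.exists_extension F rfl hl
      (φ (-j - 1) n h - BTensor.map (T.cx.d (-j) (-j - 1)).hom LinearMap.id ∘ₗ a)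
      (LinearMap.ext fun x => by
        have h₁ := LinearMap.congr_fun (hφ (-j - 1) n (-j) (n + 1) h (by omega) hi) x
        have h₂ := congrArg (BTensor.map (T.cx.d (-j) (-j - 1)).hom
          (LinearMap.id (R := Env k A) (M := X))) (LinearMap.congr_fun hab x)
        simp only [LinearMap.comp_apply, LinearMap.add_apply, map_add, BTensor.map_map,
          d_comp_d_hom, BTensor.map_zero_left, zero_add] at h₁ h₂
        simp only [LinearMap.comp_apply, LinearMap.sub_apply, h₁, h₂, sub_self,
          LinearMap.zero_apply])
    exact ⟨c, a, by rw [hc, add_sub_cancel]⟩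

end CompleteResolution

end Coefficients

section CapComposition

variable {k : Type u} {A : Type w} [Field k] [Ring A] [Algebra k A]
variable {L : Type*} [AddCommGroup L] [Module k L] [Module (Env k A) L]
  [IsScalarTower k (Env k A) L]
variable {M : Type*} [AddCommGroup M] [Module k M] [Module (Env k A) M]
  [IsScalarTower k (Env k A) M]
variable {N : Type*} [AddCommGroup N] [Module k N] [Module (Env k A) N]
  [IsScalarTower k (Env k A) N]
variable {X : Type*} [AddCommGroup X] [Module k X] [Module (Env k A) X]
  [IsScalarTower k (Env k A) X]
variable {X' : Type*} [AddCommGroup X'] [Module k X'] [Module (Env k A) X']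
  [IsScalarTower k (Env k A) X']
variable {Y : Type*} [AddCommGroup Y] [Module k Y] [Module (Env k A) Y]
  [IsScalarTower k (Env k A) Y]
variable {Z : Type*} [AddCommGroup Z] [Module k Z] [Module (Env k A) Z]
  [IsScalarTower k (Env k A) Z]

/-! ### The right unit and naturality of associativity -/

variable (k A X) in
/-- The bimodule map `X → X ⊗_A A`, `x ↦ x ⊗ 1`. -/
def BTensor.tmulOne : X →ₗ[Env k A] BTensor k A X A :=
  bimoduleHom k ((bmk k A).flip 1) (fun a b x => by
    simp only [LinearMap.flip_apply]
    rw [ract_bmk, lact_bmk, self_ract, one_mul, lact_ract_comm, bmk_balanced, self_lact,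
      mul_one])

@[simp]
theorem BTensor.tmulOne_apply (x : X) : BTensor.tmulOne k A X x = bmk k A x 1 := rfl

variable (k A X) in
/-- The isomorphism `X ⊗_A A → X`, `x ⊗ a ↦ x a`. -/
def BTensor.rightUnit : BTensor k A X A →ₗ[Env k A] X :=
  BTensor.liftE (ractₗ k A X).flip
    (fun a x y => by simp [self_lact, ract_mul])
    (fun a b x y => by simp [self_ract, ract_mul, lact_ract_comm])

@[simp]
theorem BTensor.rightUnit_bmk (x : X) (a : A) :
    BTensor.rightUnit k A X (bmk k A x a) = ract k a x :=
  BTensor.liftE_bmk (A := A) (ractₗ k A X).flip _ _ x a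

theorem BTensor.rightUnit_map (f : X →ₗ[Env k A] Y) (z : BTensor k A X A) :
    BTensor.rightUnit k A Y (BTensor.map f LinearMap.id z) = f (BTensor.rightUnit k A X z) := by
  induction z using BTensor.induction with
  | h0 => simp
  | ha z z' h h' => simp only [map_add, h, h']
  | h x a => simp [map_ract]

theorem BTensor.assocHom_map (f : X →ₗ[Env k A] X') (z : BTensor k A (BTensor k A X Y) Z) :
    BTensor.assocHom (BTensor.map (BTensor.map f LinearMap.id) LinearMap.id z) =
      BTensor.map f LinearMap.id (BTensor.assocHom z) := by
  induction z using BTensor.induction with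
  | h0 => simp
  | ha z z' h h' => simp only [map_add, h, h']
  | h t z =>
    induction t using BTensor.induction with
    | h0 => simp
    | ha t t' h h' => simp only [map_add, LinearMap.add_apply, h, h']
    | h x y => simp

/-! ### Properties of `capAux` -/

theorem capAux_sub (D D' : X →ₗ[Env k A] BTensor k A Y M) (z : ETensor k A X N) :
    capAux (D - D') z = capAux D z - capAux D' z := by
  rw [eq_sub_iff_add_eq, ← capAux_add, sub_add_cancel]

/-- Two successive caps are a single cap along the composite `(D ⊗ id) E`, which reduces the theorem
to comparing maps out of `T`. -/
theorem capAux_capAux (D : Y →ₗ[Env k A] BTensor k A Z L) (E : X →ₗ[Env k A] BTensor k A Y M)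
    (z : ETensor k A X N) :
    capAux D (capAux E z) =
      ETensor.map LinearMap.id (BTensor.assoc (X := L) (Y := M) (Z := N)).toLinearMap
        (capAux (BTensor.assocHom ∘ₗ BTensor.map D LinearMap.id ∘ₗ E) z) := by
  induction z using ETensor.induction with
  | h0 => simp
  | ha z z' h h' => simp only [map_add, h, h']
  | h x y =>
    simp only [capAux, LinearMap.comp_apply, ETensor.map_emk]
    generalize E x = t
    induction t using BTensor.induction with
    | h0 => simp
    | ha t t' h h' => simp only [map_add, LinearMap.add_apply, h, h']
    | h t m =>
      simp only [ETensor.assocHom_emk, ETensor.map_emk, BTensor.map_bmk, LinearMap.id_apply]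
      generalize D t = t
      induction t using BTensor.induction with
      | h0 => simp
      | ha t t' h h' => simp only [map_add, LinearMap.add_apply, h, h']
      | h t l =>
        simp only [ETensor.assocHom_emk, ETensor.map_emk, BTensor.assocHom_bmk,
          LinearMap.id_apply]
        congr 1

/-! ### The chain map `T → T ⊗_A M` of a cocycle -/

section

variable {T : ChainComplex (ModuleCat.{v} (Env k A)) ℤ} (Δ : T ⟶ completeTensor T T)

/-- The component `T_n → T_i ⊗_A M` of `(id ⊗ u) Δ` for a cochain `u : T_r → M`. -/
def capHom {r : ℤ} (u : T.X r →ₗ[Env k A] M) (i n : ℤ) (h : i + r = n) :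
    T.X n →ₗ[Env k A] BTensor k A (T.X i) M :=
  BTensor.map LinearMap.id u ∘ₗ component Δ i r n h

/-- The `id ⊗ d` part of the differential is killed by the cocycle condition on `u`; the `d ⊗ id`
part carries no sign, so the maps commute with differentials strictly. -/
theorem capHom_comp_d {r : ℤ} {u : T.X r →ₗ[Env k A] M} (hu : u ∘ₗ (T.d (r + 1) r).hom = 0)
    {i n i' n' : ℤ} (h : i + r = n) (h' : i' + r = n') (hi : i + 1 = i') :
    capHom Δ u i n h ∘ₗ (T.d n' n).hom =
      BTensor.map (T.d i' i).hom LinearMap.id ∘ₗ capHom Δ u i' n' h' := by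
  have e := component_d_comp Δ (show n + 1 = n' by omega) h hi rfl LinearMap.id u
  rw [hu, BTensor.map_zero_right', LinearMap.zero_comp, smul_zero, add_zero] at e
  rw [capHom, LinearMap.comp_assoc, e]
  exact LinearMap.ext fun x => by simp [capHom, BTensor.map_map]

theorem cup_comp_d {r s m : ℤ} {u : T.X r →ₗ[Env k A] L} {v : T.X s →ₗ[Env k A] M}
    (hu : u ∘ₗ (T.d (r + 1) r).hom = 0) (hv : v ∘ₗ (T.d (s + 1) s).hom = 0) (h : r + s = m) :
    (BTensor.map u v ∘ₗ component Δ r s m h) ∘ₗ (T.d (m + 1) m).hom = 0 := by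
  rw [LinearMap.comp_assoc, component_d_comp Δ rfl h rfl rfl, hu, hv, BTensor.map_zero_left',
    BTensor.map_zero_right']
  simp

end

/-! ### Augmentations and homotopies of the chain maps of cocycles. -/

namespace CompleteResolution

variable (T : CompleteResolution.{u, w, v} k A)

theorem augment_map (f : X →ₗ[Env k A] Y) (z : BTensor k A (T.cx.X 0) X) :
    T.augment Y (BTensor.map LinearMap.id f z) = f (T.augment X z) := by
  simp only [augment, LinearMap.comp_apply, ← BTensor.leftUnit_map, BTensor.map_map,
    LinearMap.comp_id, LinearMap.id_comp]

theorem augment_assocHom (z : BTensor k A (BTensor k A (T.cx.X 0) L) M) :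
    T.augment (BTensor k A L M) (BTensor.assocHom z) =
      BTensor.map (T.augment L) LinearMap.id z := by
  induction z using BTensor.induction with
  | h0 => simp
  | ha z z' h h' => simp only [map_add, h, h']
  | h t m =>
    induction t using BTensor.induction with
    | h0 => simp
    | ha t t' h h' => simp only [map_add, LinearMap.add_apply, h, h']
    | h x l => simp [augment, lact_bmk]

variable {T} {Δ : T.cx ⟶ completeTensor T.cx T.cx}

/-- Applying `ε` after `ε ⊗ id` gives `ε ⊗ ε` followed by multiplication, so this is the defining
property of a diagonal approximation. -/
theorem ε_augment_component (hΔ : IsDiagonalApproximation T Δ) (x : T.cx.X 0) :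
    T.ε (T.augment (T.cx.X 0) (component Δ 0 0 0 (add_zero 0) x)) = T.ε x := by
  have h : BTensor.leftUnit k A A = BTensor.mul :=
    BTensor.hom_ext fun a b => by simp [BTensor.mul, self_lact]
  conv_rhs => rw [← hΔ]
  rw [← augment_map, augment, LinearMap.comp_apply, BTensor.map_map, h]
  rfl

variable (Δ) in
-- `(ε ⊗ id)Δ` is a chain map: `ε d₁ = 0` removes the `d ⊗ id` term, and the other sign is `(-1)^0`.
theorem augment_component_comp_d {i n i' n' : ℤ} (h : 0 + i = n) (h' : 0 + i' = n')
    (hi : i + 1 = i') (x : T.cx.X n') :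
    T.augment _ (component Δ 0 i n h ((T.cx.d n' n).hom x)) =
      (T.cx.d i' i).hom (T.augment _ (component Δ 0 i' n' h' x)) := by
  rw [component_d Δ 0 i n' n (by omega) h 1 i' (zero_add 1) hi, map_add, augment_d, zero_add,
    Int.negOnePow_zero, Units.val_one, one_smul, augment_map]

/-- The composite `(ε ⊗ id) Δ : T → T` is homotopic to the identity. -/
theorem exists_homotopy_counit (F : FrobeniusSystem k A) (hΔ : IsDiagonalApproximation T Δ)
    {r r' l : ℤ} (hr : r + 1 = r') (hl : l + 1 = r) :
    ∃ (a : T.cx.X l →ₗ[Env k A] T.cx.X r) (b : T.cx.X r →ₗ[Env k A] T.cx.X r'), ∀ x,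
      T.augment _ (component Δ 0 r r (zero_add r) x) =
        x + (T.cx.d r' r).hom (b x) + a ((T.cx.d r l).hom x) := by
  obtain ⟨a, b, hab⟩ := T.exists_nullhomotopy (X := A) F 0
    (fun i n h => BTensor.tmulOne k A (T.cx.X i) ∘ₗ
      (T.augment _ ∘ₗ component Δ 0 i n (by omega) -
        -- The identity of `T`, transported along `n = i`: the indices satisfy `i + 0 = n` and are
        -- equal only propositionally. Tensoring with `A` puts the map in the form `T → T ⊗_A X`.
        (T.cx.XIsoOfEq (show n = i by omega)).hom.hom))
    (fun i n i' n' h h' hi => by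
      obtain rfl : n = i := by omega
      obtain rfl : n' = i' := by omega
      refine LinearMap.ext fun x => ?_
      simp only [HomologicalComplex.XIsoOfEq_rfl, Iso.refl_hom, ModuleCat.hom_id,
        LinearMap.comp_apply, LinearMap.sub_apply, LinearMap.id_apply, BTensor.tmulOne_apply,
        BTensor.map_bmk, map_sub, augment_component_comp_d Δ (zero_add n) (zero_add n') hi])
    ⟨0, LinearMap.ext fun x => by
      simp only [HomologicalComplex.XIsoOfEq_rfl, Iso.refl_hom, ModuleCat.hom_id,
        LinearMap.comp_apply, LinearMap.sub_apply, LinearMap.id_apply, BTensor.tmulOne_apply,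
        LinearMap.zero_apply]
      rw [augment, LinearMap.comp_apply, BTensor.map_bmk, LinearMap.id_apply,
        BTensor.leftUnit_bmk, self_lact, mul_one, map_sub, sub_eq_zero]
      exact ε_augment_component hΔ x⟩
    (add_zero r) hr hl
  refine ⟨BTensor.rightUnit k A _ ∘ₗ a, BTensor.rightUnit k A _ ∘ₗ b, fun x => ?_⟩
  have h := congrArg (BTensor.rightUnit k A (T.cx.X r)) (LinearMap.congr_fun hab x)
  simp only [HomologicalComplex.XIsoOfEq_rfl, Iso.refl_hom, ModuleCat.hom_id,
    LinearMap.comp_apply, LinearMap.sub_apply, LinearMap.id_apply, BTensor.tmulOne_apply,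
    LinearMap.add_apply, map_add, BTensor.rightUnit_bmk, BTensor.rightUnit_map, ract_one] at h
  rw [sub_eq_iff_eq_add] at h
  rw [h, LinearMap.comp_apply, LinearMap.comp_apply]
  abel

/-- The augmentation of the chain map of a cocycle `u` is cohomologous to `u`. -/
theorem exists_augment_capHom (F : FrobeniusSystem k A) (hΔ : IsDiagonalApproximation T Δ)
    {r : ℤ} {u : T.cx.X r →ₗ[Env k A] L} (hu : u ∘ₗ (T.cx.d (r + 1) r).hom = 0) :
    ∃ g : T.cx.X (r - 1) →ₗ[Env k A] L,
      T.augment L ∘ₗ capHom Δ u 0 r (zero_add r) = u + g ∘ₗ (T.cx.d r (r - 1)).hom := by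
  obtain ⟨a, b, hab⟩ := exists_homotopy_counit F hΔ (rfl : r + 1 = r + 1) (sub_add_cancel r 1)
  -- Applying `u` to the homotopy formula kills the `d b` term, because `u` is a cocycle, and leaves
  -- the coboundary of `u ∘ a`.
  refine ⟨u ∘ₗ a, LinearMap.ext fun x => ?_⟩
  have h : u ((T.cx.d (r + 1) r).hom (b x)) = 0 := LinearMap.congr_fun hu (b x)
  simp only [capHom, LinearMap.comp_apply, augment_map, hab, map_add, h, add_zero,
    LinearMap.add_apply]

/-- The chain maps `T → T ⊗_A (L ⊗_A M)` underlying `u ⌢ (v ⌢ _)` and `(u ⌣ v) ⌢ _` are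
homotopic. -/
theorem exists_capHom_homotopy (F : FrobeniusSystem k A) (hΔ : IsDiagonalApproximation T Δ)
    {r s m n p q : ℤ} {u : T.cx.X r →ₗ[Env k A] L} {v : T.cx.X s →ₗ[Env k A] M}
    (hu : u ∘ₗ (T.cx.d (r + 1) r).hom = 0) (hv : v ∘ₗ (T.cx.d (s + 1) s).hom = 0)
    (hm : r + s = m) (hp : p + s = n) (hq : q + r = p) (hmn : q + m = n) :
    ∃ (a : T.cx.X (n - 1) →ₗ[Env k A] BTensor k A (T.cx.X q) (BTensor k A L M))
      (b : T.cx.X n →ₗ[Env k A] BTensor k A (T.cx.X (q + 1)) (BTensor k A L M)),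
      BTensor.assocHom ∘ₗ BTensor.map (capHom Δ u q p hq) LinearMap.id ∘ₗ capHom Δ v p n hp -
          capHom Δ (BTensor.map u v ∘ₗ component Δ r s m hm) q n hmn =
        BTensor.map (T.cx.d (q + 1) q).hom LinearMap.id ∘ₗ b +
          a ∘ₗ (T.cx.d n (n - 1)).hom := by
  subst hq
  have huv := cup_comp_d Δ hu hv hm
  -- The intermediate degree in position `0` is `0 + r`, which is not syntactically `r`; it is kept
  -- as a variable `p` so that it can be identified with `r`.
  have hε : ∀ p (h : 0 + r = p) (h' : p + s = m), ∃ g : T.cx.X (m - 1) →ₗ[Env k A] _,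
      T.augment _ ∘ₗ (BTensor.assocHom ∘ₗ BTensor.map (capHom Δ u 0 p h) LinearMap.id ∘ₗ
        capHom Δ v p m h' -
          capHom Δ (BTensor.map u v ∘ₗ component Δ r s m hm) 0 m (zero_add m)) =
      g ∘ₗ (T.cx.d m (m - 1)).hom := by
    intro p h h'
    obtain rfl : p = r := by omega
    obtain ⟨g, hg⟩ := exists_augment_capHom F hΔ hu
    obtain ⟨g', hg'⟩ := exists_augment_capHom F hΔ huv
    have e := component_d_comp Δ (sub_add_cancel m 1) (by omega) (sub_add_cancel p 1) rfl g v
    rw [hv, BTensor.map_zero_right', LinearMap.zero_comp, smul_zero, add_zero] at e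
    -- The first map augments to `((u + g d) ⊗ v)Δ`, and `(g d ⊗ v)Δ` is the coboundary of `(g ⊗
    -- v)Δ` since `v` is a cocycle; `g'` accounts for the augmentation of the second map.
    refine ⟨BTensor.map g v ∘ₗ component Δ (p - 1) s (m - 1) (by omega) - g', ?_⟩
    rw [LinearMap.comp_sub, hg', LinearMap.sub_comp, LinearMap.comp_assoc, e,
      sub_add_eq_sub_sub, sub_left_inj]
    refine LinearMap.ext fun x => ?_
    simp only [LinearMap.comp_apply, LinearMap.sub_apply, augment_assocHom, BTensor.map_map,
      hg, LinearMap.comp_id]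
    simp only [capHom, LinearMap.comp_apply, BTensor.map_map, LinearMap.comp_id,
      LinearMap.id_comp]
    rw [sub_eq_iff_eq_add, ← LinearMap.add_apply]
    congr 1
    exact BTensor.hom_ext fun y z => by simp [add_comm]
  exact T.exists_nullhomotopy F m
    (fun i n h => BTensor.assocHom ∘ₗ
      BTensor.map (capHom Δ u i (i + r) rfl) LinearMap.id ∘ₗ capHom Δ v (i + r) n (by omega) -
        capHom Δ (BTensor.map u v ∘ₗ component Δ r s m hm) i n h)
    (fun i n i' n' h h' hi => by
      have h₁ := capHom_comp_d Δ hv (show i + r + s = n by omega) (show i' + r + s = n' by omega)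
        (by omega)
      have h₂ := capHom_comp_d Δ hu (rfl : i + r = i + r) (rfl : i' + r = i' + r) hi
      rw [LinearMap.sub_comp, LinearMap.comp_sub, capHom_comp_d Δ huv h h' hi,
        LinearMap.comp_assoc, LinearMap.comp_assoc, h₁]
      congr 1
      refine LinearMap.ext fun x => ?_
      simp only [LinearMap.comp_apply, BTensor.map_map, h₂, ← BTensor.assocHom_map,
        LinearMap.comp_id])
    (hε _ _ _) hmn rfl (sub_add_cancel n 1)

end CompleteResolution

theorem map_assoc_mem_boundaries {T : ChainComplex (ModuleCat.{v} (Env k A)) ℤ} {q : ℤ}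
    (f : M →ₗ[Env k A] N) {z : ETensor k A (T.X q) M} (hz : z ∈ boundaries T M q) :
    ETensor.map LinearMap.id f z ∈ boundaries T N q := by
  obtain ⟨t, rfl⟩ := hz
  refine ⟨ETensor.map LinearMap.id f t, ?_⟩
  induction t using ETensor.induction with
  | h0 => simp
  | ha z z' h h' => simp only [map_add, h, h']
  | h x y => simp

end CapComposition

/-! ### Signs, and passage to homology classes. -/

section Classes

section

variable {k : Type u} [Field k]
variable {V : Type*} [AddCommGroup V] [Module k V]
variable {W : Type*} [AddCommGroup W] [Module k W]
variable {U : Type*} [AddCommGroup U] [Module k U]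
variable {ZV BV : Submodule k V} {ZW BW : Submodule k W} {ZU BU : Submodule k U}

theorem SubQuot.exists_mk_eq (x : SubQuot ZV BV) : ∃ v, SubQuot.mk ZV BV v = x :=
  Submodule.mkQ_surjective _ x

theorem SubQuot.mk_eq_mk {v w : ZV} (h : (v : V) - w ∈ BV) :
    SubQuot.mk ZV BV v = SubQuot.mk ZV BV w :=
  (Submodule.Quotient.eq _).2 h

theorem SubQuot.map_mk (f : V →ₗ[k] W) (hZ : ∀ v ∈ ZV, f v ∈ ZW) (hB : ∀ v ∈ BV, f v ∈ BW)
    (v : ZV) :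
    SubQuot.map f hZ hB (SubQuot.mk ZV BV v) = SubQuot.mk ZW BW ⟨f v, hZ v v.2⟩ := rfl

theorem SubQuot.map₂_mk (f : V →ₗ[k] W →ₗ[k] U) (hZ : ∀ v ∈ ZV, ∀ w ∈ ZW, f v w ∈ ZU)
    (hl : ∀ v ∈ BV, ∀ w ∈ ZW, f v w ∈ BU) (hr : ∀ v ∈ ZV, ∀ w ∈ BW, f v w ∈ BU) (v : ZV)
    (w : ZW) :
    SubQuot.map₂ f hZ hl hr (SubQuot.mk ZV BV v) (SubQuot.mk ZW BW w) =
      SubQuot.mk ZU BU ⟨f v w, hZ v v.2 w w.2⟩ := rfl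

end

variable {k : Type u} {A : Type w} [Field k] [Ring A] [Algebra k A]
variable {L : Type*} [AddCommGroup L] [Module k L] [Module (Env k A) L]
  [IsScalarTower k (Env k A) L]
variable {M : Type*} [AddCommGroup M] [Module k M] [Module (Env k A) M]
  [IsScalarTower k (Env k A) M]
variable {N : Type*} [AddCommGroup N] [Module k N] [Module (Env k A) N]
  [IsScalarTower k (Env k A) N]

theorem chainCap_cochainCup {T : ChainComplex (ModuleCat.{v} (Env k A)) ℤ}
    (Δ : T ⟶ completeTensor T T) {r s m n q : ℤ} (hm : r + s = m) (hmn : q + m = n)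
    (u : T.X r →ₗ[Env k A] L) (v : T.X s →ₗ[Env k A] M) (z : ETensor k A (T.X n) N) :
    chainCap Δ m n q hmn (cochainCup Δ r s m hm u v) z =
      ((m * q + s * r).negOnePow : ℤ) •
        capAux (capHom Δ (BTensor.map u v ∘ₗ component Δ r s m hm) q n hmn) z := by
  have h : cochainCup Δ r s m hm u v =
      ((s * r).negOnePow : ℤ) • (BTensor.map u v ∘ₗ component Δ r s m hm) := rfl
  rw [h, map_zsmul, LinearMap.smul_apply, chainCap_apply, smul_smul, Int.negOnePow_add,
    Units.val_mul, mul_comm]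
  rfl

/-- The signs of the two caps have exponents `s p` and `r q`; with `p = q + r` and `m = r + s` their
sum is `m q + s r`, the exponent occurring for `(u ⌣ v) ⌢ z`. -/
theorem chainCap_chainCap {T : ChainComplex (ModuleCat.{v} (Env k A)) ℤ}
    (Δ : T ⟶ completeTensor T T) {r s m n p q : ℤ} (hm : r + s = m) (hp : p + s = n)
    (hq : q + r = p) (u : T.X r →ₗ[Env k A] L) (v : T.X s →ₗ[Env k A] M)
    (z : ETensor k A (T.X n) N) :
    chainCap Δ r p q hq u (chainCap Δ s n p hp v z) =
      ((m * q + s * r).negOnePow : ℤ) •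
        capAux (capHom Δ u q p hq) (capAux (capHom Δ v p n hp) z) := by
  rw [chainCap_apply Δ s, map_zsmul, chainCap_apply, smul_smul, ← Units.val_mul,
    ← Int.negOnePow_add, show s * p + r * q = m * q + s * r by subst hm hq; ring]
  rfl

/-- Associativity of the cap product on the level of chains, up to a boundary. -/
theorem map_assoc_chainCap_sub_mem_boundaries (F : FrobeniusSystem k A)
    (T : CompleteResolution.{u, w, v} k A) {Δ : T.cx ⟶ completeTensor T.cx T.cx}
    (hΔ : IsDiagonalApproximation T Δ) {r s m n p q : ℤ} (hm : r + s = m) (hp : p + s = n)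
    (hq : q + r = p) (hmn : q + m = n) {u : T.cx.X r →ₗ[Env k A] L}
    (hu : u ∈ cocycles T.cx L r) {v : T.cx.X s →ₗ[Env k A] M} (hv : v ∈ cocycles T.cx M s)
    {z : ETensor k A (T.cx.X n) N} (hz : z ∈ cycles T.cx N n) :
    ETensor.map LinearMap.id (BTensor.assoc (X := L) (Y := M) (Z := N)).toLinearMap
        (chainCap Δ m n q hmn (cochainCup Δ r s m hm u v) z) -
      chainCap Δ r p q hq u (chainCap Δ s n p hp v z) ∈ boundaries T.cx _ q := by
  rw [mem_cocycles] at hu hv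
  rw [cycles, LinearMap.mem_ker] at hz
  obtain ⟨a, b, hab⟩ := CompleteResolution.exists_capHom_homotopy F hΔ hu hv hm hp hq hmn
  rw [chainCap_cochainCup, chainCap_chainCap Δ hm, capAux_capAux, map_zsmul, ← smul_sub,
    ← map_sub, ← capAux_sub, ← neg_sub, hab]
  refine Submodule.smul_of_tower_mem _ _ (map_assoc_mem_boundaries _ ?_)
  -- In the homotopy `d b + a d`, the term `a d` contributes nothing because `z` is a cycle, and `d
  -- b` contributes a boundary.
  rw [← zero_sub, capAux_sub, capAux_zero, zero_sub, capAux_add, capAux_comp a, hz, map_zero,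
    add_zero, ← map_capAux]
  exact Submodule.neg_mem _ ⟨_, rfl⟩

theorem TateCohomology.exists_mk_eq {T : ChainComplex (ModuleCat.{v} (Env k A)) ℤ} {n : ℤ}
    (α : TateCohomology T M n) :
    ∃ u, SubQuot.mk (cocycles T M n) (coboundaries T M n) u = α :=
  SubQuot.exists_mk_eq (ZV := cocycles T M n) (BV := coboundaries T M n) α

theorem TateHomology.exists_mk_eq {T : ChainComplex (ModuleCat.{v} (Env k A)) ℤ} {n : ℤ}
    (ω : TateHomology T M n) :
    ∃ z, SubQuot.mk (cycles T M n) (boundaries T M n) z = ω :=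
  SubQuot.exists_mk_eq (ZV := cycles T M n) (BV := boundaries T M n) ω

/-- The membership proof is bound existentially so that the formula on representatives can be
rewritten with, without restating the proof hidden in the product. The same form is used for
`cap_mk` and `TateHomology.map_mk`. -/
theorem cup_mk {T : ChainComplex (ModuleCat.{v} (Env k A)) ℤ} (Δ : T ⟶ completeTensor T T)
    {r s m : ℤ} (h : r + s = m) (u : cocycles T L r) (v : cocycles T M s) :
    ∃ hc, cup Δ r s m h (SubQuot.mk _ _ u) (SubQuot.mk _ _ v) =
      SubQuot.mk _ _ ⟨cochainCup Δ r s m h u.1 v.1, hc⟩ :=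
  ⟨_, SubQuot.map₂_mk _ _ _ _ u v⟩

theorem cap_mk {T : ChainComplex (ModuleCat.{v} (Env k A)) ℤ} (Δ : T ⟶ completeTensor T T)
    {r n q : ℤ} (h : q + r = n) (u : cocycles T L r) (z : cycles T N n) :
    ∃ hc, cap Δ r n q h (SubQuot.mk _ _ u) (SubQuot.mk _ _ z) =
      SubQuot.mk _ _ ⟨chainCap Δ r n q h u.1 z.1, hc⟩ :=
  ⟨_, SubQuot.map₂_mk _ _ _ _ u z⟩

theorem TateHomology.map_mk {T : ChainComplex (ModuleCat.{v} (Env k A)) ℤ}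
    (f : M →ₗ[Env k A] N) (n : ℤ) (z : cycles T M n) :
    ∃ hc, TateHomology.map f n (SubQuot.mk _ _ z) =
      SubQuot.mk _ _ ⟨ETensor.map LinearMap.id f z.1, hc⟩ :=
  ⟨_, SubQuot.map_mk _ _ _ z⟩

end Classes

end TateHochschild

set_option maxHeartbeats 2000000 in
theorem corollary3p14 {k : Type u} [Field k] {A : Type w} [Ring A] [Algebra k A]
    (hA : TateHochschild.IsFrobeniusAlgebra k A)
    (T : TateHochschild.CompleteResolution.{u, w, v} k A)
    (Δ : T.cx ⟶ TateHochschild.completeTensor T.cx T.cx)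
    (hΔ : TateHochschild.IsDiagonalApproximation T Δ)
    {L : Type v₁} [AddCommGroup L] [Module k L] [Module (TateHochschild.Env k A) L]
    [IsScalarTower k (TateHochschild.Env k A) L]
    {M : Type v₂} [AddCommGroup M] [Module k M] [Module (TateHochschild.Env k A) M]
    [IsScalarTower k (TateHochschild.Env k A) M]
    {N : Type v₃} [AddCommGroup N] [Module k N] [Module (TateHochschild.Env k A) N]
    [IsScalarTower k (TateHochschild.Env k A) N]
    (r s n m p q : ℤ) (hm : r + s = m) (hp : p + s = n) (hq : q + r = p)
    (α : TateHochschild.TateCohomology T.cx L r)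
    (β : TateHochschild.TateCohomology T.cx M s)
    (ω : TateHochschild.TateHomology T.cx N n) :
    TateHochschild.TateHomology.map
        (TateHochschild.BTensor.assoc (X := L) (Y := M) (Z := N)).toLinearMap q
        (TateHochschild.cap Δ m n q (by omega) (TateHochschild.cup Δ r s m hm α β) ω) =
      TateHochschild.cap Δ r p q hq α (TateHochschild.cap Δ s n p hp β ω) := by
  obtain ⟨F⟩ := hA.nonempty_frobeniusSystem
  obtain ⟨u, hu⟩ := TateHochschild.TateCohomology.exists_mk_eq
    (T := T.cx) (M := L) (n := r) α
  obtain ⟨v, hv⟩ := TateHochschild.TateCohomology.exists_mk_eq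
    (T := T.cx) (M := M) (n := s) β
  obtain ⟨z, hz⟩ := TateHochschild.TateHomology.exists_mk_eq
    (T := T.cx) (M := N) (n := n) ω
  rw [← hu, ← hv, ← hz]
  obtain ⟨h₁, e₁⟩ := TateHochschild.cup_mk Δ hm u v
  have hmn : q + m = n := by omega
  obtain ⟨h₂, e₂⟩ := TateHochschild.cap_mk Δ hmn ⟨_, h₁⟩ z
  obtain ⟨h₃, e₃⟩ := TateHochschild.cap_mk Δ hp v z
  obtain ⟨h₄, e₄⟩ := TateHochschild.cap_mk Δ hq u ⟨_, h₃⟩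
  obtain ⟨h₅, e₅⟩ := TateHochschild.TateHomology.map_mk
    (TateHochschild.BTensor.assoc (X := L) (Y := M) (Z := N)).toLinearMap q ⟨_, h₂⟩
  rw [e₁, e₂, e₃, e₄, e₅]
  exact TateHochschild.SubQuot.mk_eq_mk
    (TateHochschild.map_assoc_chainCap_sub_mem_boundaries F T hΔ hm hp hq hmn u.2 v.2 z.2)
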